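/- Let $k,r\ge 0$ be integers, $R=\mathbb{R}[x_0,\dots,x_k]$, and let $\Delta\subseteq\mathbb{R}^k$ be a finite simplicial complex all of whose maximal faces are $k$-dimensional. For such a complex $K$, write $K_i$ for its set of $i$-dimensional faces, and let $\partial K$ be the set of faces of $K$ contained in some $\tau\in K_{k-1}$ that lies in exactly one $k$-dimensional face of $K$; faces not in $\partial K$ are called interior. Embed $\mathbb{R}^k$ in $\mathbb{R}^{k+1}$ by $v\mapsto(1,v)$, and let $\widehat K$ be the cone over $K$ with apex the origin, whose maximal cells are the simplices $\widehat s=\operatorname{conv}(\{0\}\cup\{(1,v): v \text{ a vertex of } s\})$, $s\in K_k$. The spline module $S^r(\widehat K)$ is the $R$-module of all functions of class $C^r$ on $|\widehat K|=\bigcup_{s\in K_k}\widehat s$ that are given by a polynomial in $R$ on each $\widehat s$. For a face $\gamma$ of $K$, let $J(K)_\gamma\subseteq R$ be the ideal generated by the powers $l_{\widehat\tau}^{\,r+1}$ for all $\tau\in K_{k-1}$ with $\gamma\subseteq\tau$, where $l_{\widehat\tau}$ is a nonzero linear form vanishing on $\{(1,v):v\in\tau\}$. Let $\sigma\in\Delta_k$,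 and let $\Delta''$ be a subdivision of $\sigma$ (a finite simplicial complex with $|\Delta''|=\sigma$) such that an interior face of $\Delta$ is a proper face of $\sigma$ if and only if it belongs to $\partial\Delta''$. Let $\Delta'$ consist of the faces of $\Delta''$ and all faces of the cells in $\Delta_k\setminus\{\sigma\}$, and suppose that $\Delta'$ is a simplicial complex. Suppose that $\Delta'$ is a split subdivision of $\Delta$, that is, $$J(\Delta')_\gamma=J(\Delta)_\gamma\qquad\text{for every face }\gamma\in\partial\Delta''\text{ with }\gamma\notin\partial\Delta'.$$ If $S^r(\widehat\Delta)$ and $S^r(\widehat\Delta'')$ are both free over $R$, then $S^r(\widehat\Delta')$ is free over $R$. -/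

import Mathlib

noncomputable section

namespace SplitSpline

open Geometry

/-- The polynomial ring `R = ℝ[x₀, …, x_k]`. -/
abbrev PolyRing (k : ℕ) : Type := MvPolynomial (Fin (k + 1)) ℝ

/-- The `k`-dimensional faces (maximal cells) of a complex in `ℝᵏ`. -/
def cells {k : ℕ} (K : SimplicialComplex ℝ (Fin k → ℝ)) : Set (Finset (Fin k → ℝ)) :=
  {s | s ∈ K.faces ∧ s.card = k + 1}

/-- A finite `k`-dimensional mesh in `ℝᵏ`: finitely many faces, each of them a face of a
`k`-dimensional one. -/
structure IsMesh {k : ℕ} (K : SimplicialComplex ℝ (Fin k → ℝ)) : Prop where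
  finite : K.faces.Finite
  pure : ∀ γ ∈ K.faces, ∃ s ∈ cells K, γ ⊆ s

/-- The faces of the boundary complex `∂K` of a mesh: the faces of those `(k-1)`-dimensional
faces that lie in exactly one `k`-dimensional face. All other faces are interior. -/
def boundary {k : ℕ} (K : SimplicialComplex ℝ (Fin k → ℝ)) : Set (Finset (Fin k → ℝ)) :=
  {γ | γ ∈ K.faces ∧ ∃ τ ∈ K.faces, τ.card = k ∧ γ ⊆ τ ∧ ∃! s, s ∈ cells K ∧ τ ⊆ s}

/-- The embedding `v ↦ (1, v)` of `ℝᵏ` as the hyperplane `x₀ = 1` of `ℝᵏ⁺¹`. -/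
def lift {k : ℕ} (v : Fin k → ℝ) : Fin (k + 1) → ℝ := Matrix.vecCons 1 v

/-- The cone over the simplex with vertex set `s`: the simplex in `ℝᵏ⁺¹` spanned by the origin
and the lifted vertices of `s`. -/
def coneCell {k : ℕ} (s : Finset (Fin k → ℝ)) : Set (Fin (k + 1) → ℝ) :=
  convexHull ℝ (insert 0 (lift '' (s : Set (Fin k → ℝ))))

/-- The underlying space of the cone over a mesh. -/
def coneSpace {k : ℕ} (K : SimplicialComplex ℝ (Fin k → ℝ)) : Set (Fin (k + 1) → ℝ) :=
  ⋃ s ∈ cells K, coneCell s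

/-- The module of splines of smoothness `r` on the cone over `K`: the functions of class `C^r` on
the underlying space of the cone which are given by a polynomial on each maximal cell. A spline is
recorded by the family of its polynomial pieces (which it determines, the cells being
full-dimensional); the ring `R` acts by multiplication. -/
def splines {k : ℕ} (r : ℕ) (K : SimplicialComplex ℝ (Fin k → ℝ)) :
    Submodule (PolyRing k) (cells K → PolyRing k) where
  carrier := {f | ∃ F : (Fin (k + 1) → ℝ) → ℝ, ContDiffOn ℝ r F (coneSpace K) ∧
    ∀ s : cells K, ∀ x ∈ coneCell s.1, F x = MvPolynomial.eval x (f s)}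
  zero_mem' := ⟨fun _ => 0, contDiffOn_const, by simp⟩
  add_mem' := by
    rintro f g ⟨F, hF, hf⟩ ⟨G, hG, hg⟩
    exact ⟨fun x => F x + G x, hF.add hG, fun s x hx => by simp [hf s x hx, hg s x hx]⟩
  smul_mem' := by
    rintro p f ⟨F, hF, hf⟩
    have hp : ContDiff ℝ r (fun x : Fin (k + 1) → ℝ => MvPolynomial.eval x p) := by
      induction p using MvPolynomial.induction_on with
      | C a => simpa using contDiff_const
      | add p q hp hq => simpa using hp.add hq
      | mul_X p i hp => simpa using hp.mul (contDiff_apply ℝ ℝ i)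
    exact ⟨fun x => MvPolynomial.eval x p * F x, hp.contDiffOn.mul hF,
      fun s x hx => by simp [hf s x hx]⟩

/-- The ideal `J(K)_γ`, generated by the `(r+1)`-st powers of the linear forms vanishing on the
lifts of the `(k-1)`-dimensional faces `τ ⊇ γ` of `K`. (For each `τ` these linear forms are the
scalar multiples of the homogenized equation of the affine span of `τ`.) -/
def faceIdeal {k : ℕ} (r : ℕ) (K : SimplicialComplex ℝ (Fin k → ℝ)) (γ : Finset (Fin k → ℝ)) :
    Ideal (PolyRing k) :=
  Ideal.span {p | ∃ τ ∈ K.faces, τ.card = k ∧ γ ⊆ τ ∧ ∃ l : PolyRing k,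
    l.IsHomogeneous 1 ∧ (∀ v ∈ τ, MvPolynomial.eval (lift v) l = 0) ∧ p = l ^ (r + 1)}

/-- `Δ'` is the simple subdivision of `Δ` obtained by replacing the maximal cell `σ` by its
subdivision `Δ''`. That `Δ'` is again a simplicial complex is part of its type. -/
structure IsSimpleSubdivision {k : ℕ} (Δ : SimplicialComplex ℝ (Fin k → ℝ))
    (σ : Finset (Fin k → ℝ)) (Δ'' Δ' : SimplicialComplex ℝ (Fin k → ℝ)) : Prop where
  cell_mem : σ ∈ cells Δ
  /-- `Δ''` is a (finite) subdivision of the simplex `σ` -/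
  finite : Δ''.faces.Finite
  space_eq : Δ''.space = convexHull ℝ (σ : Set (Fin k → ℝ))
  /-- `∂σ` and `∂Δ''` have the same faces among the interior faces of `Δ` -/
  boundary_eq : ∀ γ ∈ Δ.faces, γ ∉ boundary Δ → (γ ⊂ σ ↔ γ ∈ boundary Δ'')
  /-- the faces of `Δ'` are those of `Δ''` and those of the cells of `Δ` other than `σ` -/
  faces_eq : Δ'.faces = Δ''.faces ∪ {γ | γ.Nonempty ∧ ∃ t ∈ cells Δ, t ≠ σ ∧ γ ⊆ t}

/-- A simple subdivision is split (for smoothness `r`) if `J(Δ')_γ = J(Δ)_γ` for all faces `γ`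
of `∂Δ''` which are not in `∂Δ'`. -/
structure IsSplitSubdivision {k : ℕ} (r : ℕ) (Δ : SimplicialComplex ℝ (Fin k → ℝ))
    (σ : Finset (Fin k → ℝ)) (Δ'' Δ' : SimplicialComplex ℝ (Fin k → ℝ)) : Prop
    extends IsSimpleSubdivision Δ σ Δ'' Δ' where
  split : ∀ γ ∈ boundary Δ'', γ ∉ boundary Δ' → faceIdeal r Δ' γ = faceIdeal r Δ γ

end SplitSpline

end

/-! Restriction of splines is a map `ρ : S(Δ') → S(Δ'')`, and evaluation on σ is a map `ε : S(Δ) →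
R`, onto because of the constants. Their kernels are isomorphic (`kerEquiv`): a spline on Δ that is
zero on σ is the same thing as a spline on Δ' that is zero on the subdivided σ. If ρ is onto, both
sequences split and S(Δ') ≅ ker ε ⊕ S(Δ''). One free summand R of S(Δ'') completes ker ε to S(Δ), so
S(Δ') is S(Δ) plus a free module (`free_of_surjective`).

Surjectivity of ρ is `exists_extension`. A spline on Δ'' prescribes jumps across the facets that σ
shares with other cells, and zero jumps are wanted across the remaining facets, all modulo the
powers l_p^(r+1) of the facet forms. So a vector u must lie in the range of the jump map from the
piecewise polynomials on Δ to ∏ R/(l_p^(r+1)), whose kernel is S(Δ). As this kernel is free, a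
Koszul argument shows that u lies in the range as soon as its multiples by three independent linear
forms do (`mem_range_of_smul_mem`). Iterating, u may be multiplied by ∏ l_p^(e_p); the conditions
with e_p ≥ r+1 become void, and one may stop once the other forms span at most a plane
(`mem_range_of_prod_smul_mem`).

The planar problem (`exists_local_solution`) has content only if two shared facets of σ, towards t₁
and t₂, meet in a face γ of codimension two, and then only the difference D of the two jumps
matters. If γ lies in a boundary facet, the star of γ is cut open there and D can be placed on one
side. Otherwise D lies in J(Δ')_γ, which equals J(Δ)_γ as the subdivision is split. By linearity D
may be taken to be a generator belonging to a facet τ over γ. Removing σ and τ from the star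
separates t₁ from t₂, and D on the component of t₁ and 0 elsewhere is a solution
(`exists_solution_single`).

Freeness is used twice more: it allows smoothness to be tested across facets only
(`mem_splines_of_facetCompatible`), and it makes the stars of faces connected through facets
(`reflTransGen_adjOver_of_free`). -/

noncomputable section

namespace SplitSpline

open MvPolynomial Module Filter Topology

/-! ### Ideals generated by independent linear forms. -/

section LinearForms

variable {k : ℕ}

/-- The linear form with coefficient vector `a`. -/
def form (a : Fin (k + 1) → ℝ) : PolyRing k := ∑ i, C (a i) * X i

theorem eval_form (a x : Fin (k + 1) → ℝ) : eval x (form a) = a ⬝ᵥ x := by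
  simp [form, dotProduct]

theorem form_isHomogeneous (a : Fin (k + 1) → ℝ) : (form a).IsHomogeneous 1 := by
  refine IsHomogeneous.sum _ _ _ fun i _ => ?_
  simpa using (isHomogeneous_C (Fin (k + 1)) (a i)).mul (isHomogeneous_X ℝ i)

theorem exists_dual_family {ι : Type*} [Fintype ι] [DecidableEq ι] {a : ι → Fin (k + 1) → ℝ}
    (h : LinearIndependent ℝ a) :
    ∃ e : ι → Fin (k + 1) → ℝ, ∀ i j, a i ⬝ᵥ e j = if i = j then 1 else 0 := by
  obtain ⟨g, hg⟩ := (Fintype.linearCombination ℝ a).exists_leftInverse_of_injective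
    (LinearMap.ker_eq_bot.2 (linearIndependent_iff_injective_fintypeLinearCombination.1 h))
  refine ⟨fun j m => g (Pi.single m 1) j, fun i j => ?_⟩
  have h1 : g (a i) = Pi.single i 1 := by
    have := LinearMap.congr_fun hg (Pi.single i 1)
    simpa [Fintype.linearCombination_apply_single] using this
  have h2 : a i = ∑ m, a i m • (Pi.single m 1 : Fin (k + 1) → ℝ) := by
    ext m; simp [Finset.sum_apply, Pi.single_apply]
  have h3 : g (a i) j = ∑ m, a i m * g (Pi.single m 1) j := by
    conv_lhs => rw [h2]
    simp [map_sum, Finset.sum_apply]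
  rw [dotProduct, ← h3, h1, Pi.single_apply]
  simp [eq_comm]

/-- Substitution of the projection along the vectors `e j` onto the common zero space of the
linear forms `a j`. -/
def projHom {ι : Type*} [Fintype ι] (a e : ι → Fin (k + 1) → ℝ) : PolyRing k →ₐ[ℝ] PolyRing k :=
  aeval fun i => X i - ∑ j, C (e j i) * form (a j)

theorem projHom_form {ι : Type*} [Fintype ι] (a e : ι → Fin (k + 1) → ℝ)
    (b : Fin (k + 1) → ℝ) :
    projHom a e (form b) = form (b - ∑ j, (b ⬝ᵥ e j) • a j) := by
  apply MvPolynomial.funext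
  intro x
  have : ∀ i, eval x (projHom a e (X i)) = x i - ∑ j, e j i * (a j ⬝ᵥ x) := by
    intro i; simp [projHom, eval_form]
  rw [eval_form, form, map_sum, map_sum]
  simp only [map_mul, this]
  have hC : ∀ c : ℝ, eval x (projHom a e (C c)) = c := by intro c; simp [projHom]
  simp only [hC, mul_sub, Finset.sum_sub_distrib, sub_dotProduct, sum_dotProduct,
    smul_dotProduct, smul_eq_mul]
  congr 1
  have h : ∀ j, (b ⬝ᵥ e j) * (a j ⬝ᵥ x) = ∑ i, b i * (e j i * (a j ⬝ᵥ x)) := by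
    intro j
    conv_lhs => rw [dotProduct, Finset.sum_mul]
    exact Finset.sum_congr rfl fun i _ => by ring
  simp only [h, Finset.mul_sum]
  exact Finset.sum_comm

/-- The substitution moves each variable by an element of the ideal, hence fixes every polynomial
modulo the ideal. Being the kernel of an endomorphism of a domain, the ideal is prime, and
membership in it can be tested by substituting. -/
theorem ker_projHom {ι : Type*} [Fintype ι] {a e : ι → Fin (k + 1) → ℝ} [DecidableEq ι]
    (h : ∀ i j, a i ⬝ᵥ e j = if i = j then 1 else 0) :
    RingHom.ker (projHom a e) = Ideal.span (Set.range fun j => form (a j)) := by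
  apply le_antisymm
  · intro p hp
    set I := Ideal.span (Set.range fun j => form (a j))
    have key : (Ideal.Quotient.mkₐ ℝ I).comp (projHom a e) = Ideal.Quotient.mkₐ ℝ I := by
      apply MvPolynomial.algHom_ext
      intro i
      simp only [AlgHom.comp_apply, projHom, aeval_X, Ideal.Quotient.mkₐ_eq_mk]
      rw [Ideal.Quotient.eq, sub_sub_cancel_left, neg_mem_iff]
      exact sum_mem fun j _ => I.mul_mem_left _ (Ideal.subset_span ⟨j, rfl⟩)
    have := DFunLike.congr_fun key p
    rw [AlgHom.comp_apply, (RingHom.mem_ker).1 hp, map_zero] at this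
    exact Ideal.Quotient.eq_zero_iff_mem.1 this.symm
  · rw [Ideal.span_le]
    rintro _ ⟨j, rfl⟩
    simp only [SetLike.mem_coe, RingHom.mem_ker]
    rw [projHom_form]
    simp [h, form]

theorem form_eq_zero_iff {a : Fin (k + 1) → ℝ} : form a = 0 ↔ a = 0 := by
  refine ⟨fun h => ?_, fun h => by simp [h, form]⟩
  have := eval_form a a
  rw [h, map_zero, eq_comm, dotProduct_self_eq_zero] at this
  exact this

theorem isPrime_span_form {ι : Type*} [Fintype ι] {a : ι → Fin (k + 1) → ℝ}
    (h : LinearIndependent ℝ a) :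
    (Ideal.span (Set.range fun j => form (a j))).IsPrime := by
  classical
  obtain ⟨e, he⟩ := exists_dual_family h
  rw [← ker_projHom he]
  exact RingHom.ker_isPrime _

theorem form_mem_span_iff {ι : Type*} [Fintype ι] {a : ι → Fin (k + 1) → ℝ}
    (h : LinearIndependent ℝ a) (b : Fin (k + 1) → ℝ) :
    form b ∈ Ideal.span (Set.range fun j => form (a j)) ↔ b ∈ Submodule.span ℝ (Set.range a) := by
  classical
  obtain ⟨e, he⟩ := exists_dual_family h
  rw [← ker_projHom he, RingHom.mem_ker, projHom_form, form_eq_zero_iff, sub_eq_zero]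
  constructor
  · intro hb
    rw [hb]
    exact sum_mem fun j _ => Submodule.smul_mem _ _ (Submodule.subset_span ⟨j, rfl⟩)
  · intro hb
    obtain ⟨c, rfl⟩ := (Submodule.mem_span_range_iff_exists_fun ℝ).1 hb
    simp [sum_dotProduct, smul_dotProduct, he]

theorem prime_form {a : Fin (k + 1) → ℝ} (ha : a ≠ 0) : Prime (form a) := by
  have h1 : LinearIndependent ℝ (fun _ : Unit => a) := LinearIndependent.of_subsingleton () ha
  have := isPrime_span_form h1
  rw [Set.range_const] at this
  exact (Ideal.span_singleton_prime (form_eq_zero_iff.not.2 ha)).1 this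

theorem form_dvd_form_iff {a b : Fin (k + 1) → ℝ} (ha : a ≠ 0) :
    form a ∣ form b ↔ b ∈ Submodule.span ℝ {a} := by
  have h1 : LinearIndependent ℝ (fun _ : Unit => a) := LinearIndependent.of_subsingleton () ha
  simpa [Set.range_const, Ideal.mem_span_singleton] using form_mem_span_iff h1 b

/-- A polynomial vanishing on a hyperplane is divisible by its equation. -/
theorem form_dvd_of_eval_eq_zero {a : Fin (k + 1) → ℝ} (ha : a ≠ 0) {p : PolyRing k}
    (h : ∀ x, a ⬝ᵥ x = 0 → eval x p = 0) : form a ∣ p := by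
  classical
  have h1 : LinearIndependent ℝ (fun _ : Unit => a) := LinearIndependent.of_subsingleton () ha
  obtain ⟨e, he⟩ := exists_dual_family h1
  have h2 := ker_projHom he
  rw [Set.range_const] at h2
  rw [← Ideal.mem_span_singleton, ← h2, RingHom.mem_ker]
  apply MvPolynomial.funext
  intro x
  -- Substitution is evaluation at the projection of `x` to the hyperplane along `e ()`, where `p`
  -- vanishes.
  have : eval x (projHom (fun _ : Unit => a) e p) = eval (x - (a ⬝ᵥ x) • e ()) p := by
    have : (aeval x : PolyRing k →ₐ[ℝ] ℝ).comp (projHom (fun _ : Unit => a) e)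
        = aeval (x - (a ⬝ᵥ x) • e ()) := by
      apply MvPolynomial.algHom_ext
      intro i
      simp [projHom, aeval_eq_eval, eval_form, mul_comm]
    simpa [aeval_eq_eval] using DFunLike.congr_fun this p
  rw [this, map_zero]
  apply h
  have := he () ()
  simp only [if_true] at this
  rw [dotProduct_sub, dotProduct_smul, this]
  simp

end LinearForms

/-! ### Koszul-type descent for free modules. -/

section Koszul

variable {R : Type*} [CommRing R]

/-- If the quotient by `(l₁, l₂)` has no `l₃`-torsion, the same holds for free modules. -/
theorem free_regular {S : Type*} [AddCommGroup S] [Module R S] [Module.Free R S]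
    {l₁ l₂ l₃ : R} (h : ∀ z, l₃ * z ∈ Ideal.span {l₁, l₂} → z ∈ Ideal.span {l₁, l₂})
    {x y z : S} (hz : l₃ • z = l₁ • x + l₂ • y) : ∃ x' y' : S, z = l₁ • x' + l₂ • y' := by
  classical
  let B := Module.Free.chooseBasis R S
  have hc : ∀ i, ∃ p : R × R, B.repr z i = l₁ * p.1 + l₂ * p.2 := by
    intro i
    have h1 : l₃ * B.repr z i = l₁ * B.repr x i + l₂ * B.repr y i := by
      have := congrArg (fun w => B.repr w i) hz
      simpa using this
    have h2 := h (B.repr z i) (by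
      rw [h1, Ideal.mem_span_pair]; exact ⟨B.repr x i, B.repr y i, by ring⟩)
    obtain ⟨p, q, hpq⟩ := Ideal.mem_span_pair.1 h2
    exact ⟨(p, q), by rw [← hpq]; ring⟩
  choose p hp using hc
  refine ⟨∑ i ∈ (B.repr z).support, (p i).1 • B i, ∑ i ∈ (B.repr z).support, (p i).2 • B i, ?_⟩
  rw [Finset.smul_sum, Finset.smul_sum, ← Finset.sum_add_distrib]
  conv_lhs => rw [← B.linearCombination_repr z, Finsupp.linearCombination_apply, Finsupp.sum]
  refine Finset.sum_congr rfl fun i _ => ?_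
  rw [hp i, add_smul, mul_smul, mul_smul]

/-- In a free module over a domain, `l₁ x = l₂ y` implies `l₁ ∣ y` when `l₁`, `l₂` are coprime. -/
theorem free_coprime [IsDomain R] {S : Type*} [AddCommGroup S] [Module R S] [Module.Free R S]
    {l₁ l₂ : R} (h1 : l₁ ≠ 0) (h : ∀ z, l₁ ∣ l₂ * z → l₁ ∣ z)
    {x y : S} (hxy : l₁ • x = l₂ • y) : ∃ w : S, y = l₁ • w ∧ x = l₂ • w := by
  classical
  let B := Module.Free.chooseBasis R S
  have hc : ∀ i, ∃ p : R, B.repr y i = l₁ * p := by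
    intro i
    refine h _ ⟨B.repr x i, ?_⟩
    have := congrArg (fun w => B.repr w i) hxy
    simpa using this.symm
  choose p hp using hc
  have hy : y = l₁ • ∑ i ∈ (B.repr y).support, p i • B i := by
    rw [Finset.smul_sum]
    conv_lhs => rw [← B.linearCombination_repr y, Finsupp.linearCombination_apply, Finsupp.sum]
    refine Finset.sum_congr rfl fun i _ => ?_
    rw [hp i, mul_smul]
  refine ⟨_, hy, ?_⟩
  refine smul_right_injective S h1 ?_
  simp only
  rw [hxy, smul_comm, ← hy]

/-- Descent of solvability along a regular sequence of length three: if the kernel of `φ` is free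
and `lᵢ u` lies in the range of `φ` for `i = 1, 2, 3`, then so does `u`. -/
theorem mem_range_of_smul_mem [IsDomain R] {F N : Type*} [AddCommGroup F] [Module R F]
    [AddCommGroup N] [Module R N] [Module.Free R F] (φ : F →ₗ[R] N)
    [Module.Free R (LinearMap.ker φ)] {l₁ l₂ l₃ : R} (h1 : l₁ ≠ 0)
    (h2 : ∀ z, l₁ ∣ l₂ * z → l₁ ∣ z)
    (h3 : ∀ z, l₃ * z ∈ Ideal.span {l₁, l₂} → z ∈ Ideal.span {l₁, l₂})
    (hN : ∀ n : N, l₁ • n = 0 → l₂ • n = 0 → n = 0) {u : N}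
    (u1 : l₁ • u ∈ LinearMap.range φ) (u2 : l₂ • u ∈ LinearMap.range φ)
    (u3 : l₃ • u ∈ LinearMap.range φ) : u ∈ LinearMap.range φ := by
  obtain ⟨s₁, hs1⟩ := u1
  obtain ⟨s₂, hs2⟩ := u2
  obtain ⟨s₃, hs3⟩ := u3
  have key : ∀ {l m : R} {s t : F}, φ s = l • u → φ t = m • u →
      l • t - m • s ∈ LinearMap.ker φ := by
    intro l m s t hs ht
    rw [LinearMap.mem_ker, map_sub, map_smul, map_smul, hs, ht, smul_comm, sub_self]
  let z12 : LinearMap.ker φ := ⟨_, key hs1 hs2⟩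
  let z13 : LinearMap.ker φ := ⟨_, key hs1 hs3⟩
  let z23 : LinearMap.ker φ := ⟨_, key hs2 hs3⟩
  -- The Koszul relation between the three syzygies of the preimages `s₁`, `s₂`, `s₃`.
  have hz : l₃ • z12 = l₁ • (-z23) + l₂ • z13 := by
    apply Subtype.ext
    simp only [z12, z13, z23, Submodule.coe_smul, Submodule.coe_add, Submodule.coe_neg]
    module
  obtain ⟨t2, t1, ht⟩ := free_regular h3 hz
  have ht' : l₁ • s₂ - l₂ • s₁ = l₁ • (t2 : F) + l₂ • (t1 : F) := congrArg Subtype.val ht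
  -- Correcting `s₁` and `s₂` by kernel elements makes them proportional. By coprimality they become
  -- `l₁ • w` and `l₂ • w`, and `φ w - u` is killed by both forms.
  have hw : l₁ • (s₂ - (t2 : F)) = l₂ • (s₁ + (t1 : F)) := by
    rw [smul_sub, smul_add, sub_eq_iff_eq_add]
    rw [sub_eq_iff_eq_add] at ht'
    rw [ht']; module
  obtain ⟨w, hw1, hw2⟩ := free_coprime h1 h2 hw
  have hk1 : φ (t1 : F) = 0 := t1.2
  have hk2 : φ (t2 : F) = 0 := t2.2
  refine ⟨w, sub_eq_zero.1 (hN _ ?_ ?_)⟩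
  · rw [smul_sub, ← map_smul, ← hw1, map_add, hk1, hs1, add_zero, sub_self]
  · rw [smul_sub, ← map_smul, ← hw2, map_sub, hk2, hs2, sub_zero, sub_self]

end Koszul

/-! ### Reduction to linear forms spanning at most a plane. -/

section Descent

variable {k : ℕ}

theorem finrank_span_le_two_or {ι : Type*} (a : ι → Fin (k + 1) → ℝ) (D : Set ι) :
    finrank ℝ (Submodule.span ℝ (a '' D)) ≤ 2 ∨
      ∃ i : Fin 3 → ι, (∀ j, i j ∈ D) ∧ LinearIndependent ℝ (a ∘ i) := by
  by_cases h : finrank ℝ (Submodule.span ℝ (a '' D)) ≤ 2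
  · exact Or.inl h
  right
  push Not at h
  obtain ⟨b, hb, hspan, hli⟩ := exists_linearIndependent ℝ (a '' D)
  have hfin : b.Finite := hli.setFinite
  have : Fintype b := hfin.fintype
  have hcard : 3 ≤ Fintype.card b := by
    have := finrank_span_eq_card hli
    rw [Subtype.range_coe, hspan] at this
    rw [this] at h
    exact h
  obtain ⟨f⟩ : Nonempty (Fin 3 ↪ b) :=
    Function.Embedding.nonempty_of_card_le (by simpa using hcard)
  have hf : ∀ j, ∃ i ∈ D, a i = f j := fun j => hb (f j).2
  choose i hi hai using hf
  refine ⟨i, hi, ?_⟩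
  have : a ∘ i = (fun x : b => (x : Fin (k + 1) → ℝ)) ∘ f := by
    funext j; exact hai j
  rw [this]
  exact hli.comp f f.injective

/-- To solve `φ w = u`, it is enough to solve it after multiplication by products of powers of
linear forms such that the forms occurring with small exponents span a space of dimension at
most two. -/
theorem mem_range_of_prod_smul_mem {F N ι : Type*} [AddCommGroup F] [Module (PolyRing k) F]
    [AddCommGroup N] [Module (PolyRing k) N] [Module.Free (PolyRing k) F] [Fintype ι]
    (φ : F →ₗ[PolyRing k] N) [Module.Free (PolyRing k) (LinearMap.ker φ)]
    (a : ι → Fin (k + 1) → ℝ) (r : ℕ) (u : N)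
    (hN : ∀ b c : Fin (k + 1) → ℝ, LinearIndependent ℝ ![b, c] →
      ∀ n : N, form b • n = 0 → form c • n = 0 → n = 0)
    (hu : ∀ e : ι → ℕ, finrank ℝ (Submodule.span ℝ (a '' {i | e i < r + 1})) ≤ 2 →
      (∏ i, form (a i) ^ e i) • u ∈ LinearMap.range φ) :
    u ∈ LinearMap.range φ := by
  classical
  -- The truncated differences measure how far the exponents are from making their conditions void.
  -- Raising one exponent below `r + 1` lowers the total; the claim itself is the case of all
  -- exponents zero.
  have key : ∀ n : ℕ, ∀ e : ι → ℕ, ∑ i, (r + 1 - e i) = n →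
      (∏ i, form (a i) ^ e i) • u ∈ LinearMap.range φ := by
    intro n
    induction n using Nat.strong_induction_on with
    | _ n ih =>
    intro e he
    obtain h | ⟨i, hi, hli⟩ := finrank_span_le_two_or a {i | e i < r + 1}
    · exact hu e h
    have step : ∀ j, form (a (i j)) • (∏ i, form (a i) ^ e i) • u ∈ LinearMap.range φ := by
      intro j
      have h1 : form (a (i j)) * (∏ i, form (a i) ^ e i)
          = ∏ m, form (a m) ^ (Function.update e (i j) (e (i j) + 1)) m := by
        rw [← Finset.mul_prod_erase _ _ (Finset.mem_univ (i j)),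
          ← Finset.mul_prod_erase (a := i j) Finset.univ
            (fun m => form (a m) ^ (Function.update e (i j) (e (i j) + 1)) m) (Finset.mem_univ _),
          ← mul_assoc, Function.update_self, pow_succ' (form (a (i j)))]
        congr 1
        refine Finset.prod_congr rfl fun m hm => ?_
        rw [Function.update_of_ne (Finset.ne_of_mem_erase hm)]
      rw [← mul_smul, h1]
      refine ih _ ?_ _ rfl
      rw [← he]
      refine Finset.sum_lt_sum (fun m _ => ?_) ⟨i j, Finset.mem_univ _, ?_⟩
      · by_cases hm : m = i j
        · subst hm; simp only [Function.update_self]; omega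
        · rw [Function.update_of_ne hm]
      · have := hi j
        simp only [Set.mem_ofPred_eq] at this
        simp only [Function.update_self]; omega
    have h01 : LinearIndependent ℝ ![a (i 0), a (i 1)] := by
      have := hli.comp ![0, 1] (by decide)
      convert this using 1
      ext j; fin_cases j <;> rfl
    have hspan : ({form (a (i 0)), form (a (i 1))} : Set (PolyRing k))
        = Set.range fun j => form ((![a (i 0), a (i 1)] : Fin 2 → _) j) := by
      ext p; simp [eq_comm, Fin.exists_fin_two]
    have hne : a (i 0) ≠ 0 := hli.ne_zero 0
    refine mem_range_of_smul_mem φ (l₁ := form (a (i 0))) (l₂ := form (a (i 1)))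
      (l₃ := form (a (i 2))) (form_eq_zero_iff.not.2 hne) ?_ ?_ (hN _ _ h01) (step 0) (step 1)
      (step 2)
    · intro z hz
      refine ((prime_form hne).dvd_or_dvd hz).resolve_left fun h => ?_
      rw [form_dvd_form_iff hne] at h
      exact (LinearIndependent.pair_iff' hne).1 h01 _ (Submodule.mem_span_singleton.1 h).choose_spec
    · intro z hz
      rw [hspan] at hz ⊢
      refine ((isPrime_span_form h01).mem_or_mem hz).resolve_left fun h => ?_
      rw [form_mem_span_iff h01] at h
      have h2 := hli.notMem_span_image (s := {0, 1}) (x := 2) (by decide)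
      apply h2
      have h3 : a ∘ i '' {0, 1} = Set.range ![a (i 0), a (i 1)] := by
        rw [Set.image_pair, Matrix.range_cons, Matrix.range_cons, Matrix.range_empty,
          Set.union_empty]
        rfl
      rw [h3]
      exact h
  simpa using key _ (fun _ => 0) rfl

end Descent

/-! ### Vanishing of polynomials to order r. -/

section Jets

variable {k : ℕ}

/-- The polynomial `p` vanishes to order `r` at `x`: all its derivatives of order at most `r` at
`x` are zero. -/
def VanishesAt (r : ℕ) (p : PolyRing k) (x : Fin (k + 1) → ℝ) : Prop :=
  ∀ m ≤ r, iteratedFDeriv ℝ m (fun y => eval y p) x = 0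

theorem contDiff_eval {n : WithTop ℕ∞} (p : PolyRing k) : ContDiff ℝ n fun y => eval y p := by
  induction p using MvPolynomial.induction_on with
  | C a => simpa using contDiff_const
  | add p q hp hq => simpa using hp.add hq
  | mul_X p i hp => simpa using hp.mul (contDiff_apply ℝ ℝ i)

theorem iteratedFDeriv_eval_sub (m : ℕ) (p q : PolyRing k) (x : Fin (k + 1) → ℝ) :
    iteratedFDeriv ℝ m (fun y => eval y (p - q)) x =
      iteratedFDeriv ℝ m (fun y => eval y p) x - iteratedFDeriv ℝ m (fun y => eval y q) x := by
  have : (fun y => eval y (p - q)) = (fun y => eval y p) - fun y => eval y q := by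
    ext y; simp
  rw [this, iteratedFDeriv_sub_apply (contDiff_eval p).contDiffAt (contDiff_eval q).contDiffAt]

theorem vanishesAt_sub_iff {r : ℕ} {p q : PolyRing k} {x : Fin (k + 1) → ℝ} :
    VanishesAt r (p - q) x ↔ ∀ m ≤ r, iteratedFDeriv ℝ m (fun y => eval y p) x =
      iteratedFDeriv ℝ m (fun y => eval y q) x := by
  simp only [VanishesAt, iteratedFDeriv_eval_sub, sub_eq_zero]

theorem vanishesAt_zero (r : ℕ) (x : Fin (k + 1) → ℝ) : VanishesAt r (0 : PolyRing k) x := by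
  have := vanishesAt_sub_iff (r := r) (p := (0 : PolyRing k)) (q := 0) (x := x)
  rw [sub_zero] at this
  exact this.2 fun _ _ => rfl

theorem VanishesAt.sub {r : ℕ} {p q : PolyRing k} {x : Fin (k + 1) → ℝ}
    (hp : VanishesAt r p x) (hq : VanishesAt r q x) : VanishesAt r (p - q) x :=
  vanishesAt_sub_iff.2 fun m hm => by rw [hp m hm, hq m hm]

theorem VanishesAt.neg {r : ℕ} {p : PolyRing k} {x : Fin (k + 1) → ℝ}
    (hp : VanishesAt r p x) : VanishesAt r (-p) x := by
  simpa using (vanishesAt_zero r x).sub hp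

theorem VanishesAt.add {r : ℕ} {p q : PolyRing k} {x : Fin (k + 1) → ℝ}
    (hp : VanishesAt r p x) (hq : VanishesAt r q x) : VanishesAt r (p + q) x := by
  simpa using hp.sub hq.neg

theorem VanishesAt.eval_eq_zero {r : ℕ} {p : PolyRing k} {x : Fin (k + 1) → ℝ}
    (hp : VanishesAt r p x) : eval x p = 0 := by
  have := congrArg (fun f => f 0) (hp 0 (Nat.zero_le _))
  simpa using this

theorem VanishesAt.mul_left {r : ℕ} {p : PolyRing k} {x : Fin (k + 1) → ℝ}
    (hp : VanishesAt r p x) (q : PolyRing k) : VanishesAt r (q * p) x := by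
  intro m hm
  have h1 := norm_iteratedFDeriv_mul_le (contDiff_eval (n := (m : ℕ∞)) q)
    (contDiff_eval (n := (m : ℕ∞)) p) x (n := m) le_rfl
  have h2 : (fun y => eval y (q * p)) = fun y => eval y q * eval y p := by ext y; simp
  rw [h2, ← norm_le_zero_iff]
  refine h1.trans (Finset.sum_nonpos fun i hi => ?_)
  rw [hp (m - i) (by omega)]
  simp

/-- In the Leibniz bound, the term that does not differentiate the split-off factor contains its
value, which is zero. All other terms contain a derivative of the lower power of order covered by
the induction hypothesis. -/
theorem vanishesAt_form_pow (r : ℕ) {a x : Fin (k + 1) → ℝ} (h : a ⬝ᵥ x = 0) :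
    VanishesAt r (form a ^ (r + 1)) x := by
  induction r with
  | zero =>
    intro m hm
    obtain rfl : m = 0 := by omega
    ext v
    simp [eval_form, h]
  | succ r ih =>
    intro m hm
    have h1 := norm_iteratedFDeriv_mul_le (contDiff_eval (n := (m : ℕ∞)) (form a))
      (contDiff_eval (n := (m : ℕ∞)) (form a ^ (r + 1))) x (n := m) le_rfl
    have h2 : (fun y => eval y (form a ^ (r + 1 + 1)))
        = fun y => eval y (form a) * eval y (form a ^ (r + 1)) := by
      ext y; rw [pow_succ' _ (r + 1), map_mul]
    rw [h2, ← norm_le_zero_iff]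
    refine h1.trans (Finset.sum_nonpos fun i hi => ?_)
    rcases i with _ | i
    · rw [norm_iteratedFDeriv_zero, eval_form, h]
      simp
    · rw [ih (m - (i + 1)) (by omega)]
      simp

theorem vanishesAt_of_form_pow_dvd {r : ℕ} {a x : Fin (k + 1) → ℝ} (h : a ⬝ᵥ x = 0)
    {p : PolyRing k} (hp : form a ^ (r + 1) ∣ p) : VanishesAt r p x := by
  obtain ⟨q, rfl⟩ := hp
  rw [mul_comm]
  exact (vanishesAt_form_pow r h).mul_left q

theorem iteratedDeriv_polynomial (m : ℕ) (p : Polynomial ℝ) :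
    iteratedDeriv m (fun t => p.eval t) = fun t => (Polynomial.derivative^[m] p).eval t := by
  induction m generalizing p with
  | zero => simp
  | succ m ih =>
    rw [iteratedDeriv_succ']
    have : deriv (fun t => p.eval t) = fun t => (Polynomial.derivative p).eval t := by
      ext t; simp
    rw [this, ih, Function.iterate_succ_apply]

/-- If `form a ^ m * q` vanishes to order at least `m` at a point of the hyperplane defined by `a`,
then `q` vanishes there. -/
theorem eval_eq_zero_of_vanishesAt {r m : ℕ} (hm : m ≤ r) {a x : Fin (k + 1) → ℝ} (ha : a ≠ 0)
    (hx : a ⬝ᵥ x = 0) {q : PolyRing k} (h : VanishesAt r (form a ^ m * q) x) :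
    eval x q = 0 := by
  -- Restrict to the line through `x` in the direction `a`. There `form a ^ m` is `(a ⬝ᵥ a) ^ m`
  -- times the `m`-th power of the parameter, so the `m`-th derivative at 0 is a nonzero multiple of
  -- the value of `q` at `x`.
  let L : ℝ →L[ℝ] (Fin (k + 1) → ℝ) := ContinuousLinearMap.toSpanSingleton ℝ a
  have h1 : iteratedDeriv m (fun t : ℝ => eval (x + t • a) (form a ^ m * q)) 0 = 0 := by
    rw [iteratedDeriv_eq_iteratedFDeriv]
    have h2 : (fun t : ℝ => eval (x + t • a) (form a ^ m * q))
        = (fun y => eval (x + y) (form a ^ m * q)) ∘ L := by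
      ext t; simp [L]
    have h3 : ContDiff ℝ (m : ℕ∞) fun y => eval (x + y) (form a ^ m * q) :=
      (contDiff_eval _).comp (contDiff_const.add contDiff_id)
    rw [h2, L.iteratedFDeriv_comp_right h3 0 le_rfl,
      iteratedFDeriv_comp_add_left (f := fun y => eval y (form a ^ m * q)), map_zero, add_zero,
      h m hm]
    simp
  let φ : PolyRing k →ₐ[ℝ] Polynomial ℝ :=
    aeval fun i => Polynomial.C (x i) + Polynomial.X * Polynomial.C (a i)
  have hφ : ∀ (p : PolyRing k) (t : ℝ), (φ p).eval t = eval (x + t • a) p := by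
    intro p t
    have : ((Polynomial.aeval t).comp φ : PolyRing k →ₐ[ℝ] ℝ) = aeval (x + t • a) := by
      apply MvPolynomial.algHom_ext
      intro i
      simpa [φ] using mul_comm _ _
    simpa [aeval_eq_eval, Polynomial.coe_aeval_eq_eval] using DFunLike.congr_fun this p
  have h4 : φ (form a ^ m * q)
      = Polynomial.X ^ m * (Polynomial.C ((a ⬝ᵥ a) ^ m) * φ q) := by
    apply Polynomial.funext
    intro t
    rw [hφ]
    simp only [map_mul, map_pow, eval_form, Polynomial.eval_mul, Polynomial.eval_pow,
      Polynomial.eval_X, Polynomial.eval_C, hφ, dotProduct_add, hx, dotProduct_smul, smul_eq_mul]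
    ring
  simp only [← hφ, h4] at h1
  rw [iteratedDeriv_polynomial] at h1
  simp only [← Polynomial.coeff_zero_eq_eval_zero] at h1
  rw [Polynomial.coeff_iterate_derivative, Polynomial.coeff_X_pow_mul', if_pos (by omega),
    Polynomial.coeff_C_mul] at h1
  have h5 : (φ q).coeff 0 = 0 := by
    have ha' : a ⬝ᵥ a ≠ 0 := fun h0 => ha (dotProduct_self_eq_zero.1 h0)
    have hd : m.descFactorial m ≠ 0 := by simp [Nat.descFactorial_self, Nat.factorial_ne_zero]
    simpa [ha', hd] using h1
  rw [Polynomial.coeff_zero_eq_eval_zero, hφ] at h5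
  simpa using h5

end Jets

/-! ### Cones over simplices. -/

section Cones

variable {k : ℕ}

theorem lift_zero (v : Fin k → ℝ) : lift v 0 = 1 := rfl

theorem lift_succ (v : Fin k → ℝ) (i : Fin k) : lift v i.succ = v i := rfl

/-- The zeroth coordinate of a lift is 1, so a linear relation between lifts has weights of sum zero
and is an affine relation. -/
theorem linearIndependent_lift {s : Finset (Fin k → ℝ)}
    (h : AffineIndependent ℝ ((↑) : s → Fin k → ℝ)) :
    LinearIndependent ℝ fun v : s => lift (v : Fin k → ℝ) := by
  rw [linearIndependent_iff']
  intro t w hw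
  rw [affineIndependent_iff] at h
  refine h t w ?_ ?_
  · simpa [lift_zero] using congrFun hw 0
  · ext i
    simpa [lift_succ] using congrFun hw i.succ

/-- The apex is the origin and absorbs the missing weight, which is why the weights need only sum to
at most 1. -/
theorem mem_coneCell_iff {s : Finset (Fin k → ℝ)} {x : Fin (k + 1) → ℝ} :
    x ∈ coneCell s ↔ ∃ c : (Fin k → ℝ) → ℝ, (∀ v ∈ s, 0 ≤ c v) ∧ ∑ v ∈ s, c v ≤ 1 ∧
      x = ∑ v ∈ s, c v • lift v := by
  classical
  constructor
  · intro hx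
    refine convexHull_min (t := {x | ∃ c : (Fin k → ℝ) → ℝ, (∀ v ∈ s, 0 ≤ c v) ∧
      ∑ v ∈ s, c v ≤ 1 ∧ x = ∑ v ∈ s, c v • lift v}) ?_ ?_ hx
    · rw [Set.insert_subset_iff]
      constructor
      · exact ⟨0, by simp, by simp, by simp⟩
      · rintro _ ⟨v, hv, rfl⟩
        have hv' : v ∈ s := hv
        refine ⟨Pi.single v 1, fun w _ => ?_, ?_, ?_⟩
        · by_cases h : w = v
          · subst h; simp
          · simp [h]
        · simp [Finset.sum_pi_single', hv']
        · simp [Pi.single_apply, hv']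
    · rintro _ ⟨c, h1, h2, rfl⟩ _ ⟨d, h3, h4, rfl⟩ p q hp hq hpq
      refine ⟨fun v => p * c v + q * d v, fun v hv => ?_, ?_, ?_⟩
      · have := h1 v hv; have := h3 v hv; positivity
      · rw [Finset.sum_add_distrib, ← Finset.mul_sum, ← Finset.mul_sum]
        nlinarith
      · simp [Finset.smul_sum, Finset.sum_add_distrib, add_smul, mul_smul]
  · rintro ⟨c, h1, h2, rfl⟩
    have := (convex_convexHull ℝ (insert 0 (lift '' (s : Set (Fin k → ℝ))))).sum_mem
      (t := Finset.insertNone s) (w := fun o => o.elim (1 - ∑ v ∈ s, c v) c)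
      (z := fun o => o.elim 0 lift) ?_ ?_ ?_
    · rw [Finset.sum_insertNone] at this
      simpa [coneCell] using this
    · intro o ho
      cases o with
      | none => simpa using h2
      | some v => exact h1 v (by simpa using ho)
    · rw [Finset.sum_insertNone]
      simp
    · intro o ho
      apply subset_convexHull
      cases o with
      | none => simp
      | some v => exact Or.inr ⟨v, by simpa using ho, rfl⟩

theorem convex_coneCell (s : Finset (Fin k → ℝ)) : Convex ℝ (coneCell s) := by
  unfold coneCell
  exact convex_convexHull ℝ _

theorem isClosed_coneCell (s : Finset (Fin k → ℝ)) : IsClosed (coneCell s) :=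
  (((s.finite_toSet.image lift).insert 0).isCompact_convexHull ℝ).isClosed

theorem coneCell_mono {s t : Finset (Fin k → ℝ)} (h : s ⊆ t) : coneCell s ⊆ coneCell t :=
  convexHull_mono (Set.insert_subset_insert (Set.image_mono (by exact_mod_cast h)))

theorem dotProduct_eq_zero_of_mem_coneCell {s : Finset (Fin k → ℝ)} {a x : Fin (k + 1) → ℝ}
    (h : ∀ v ∈ s, a ⬝ᵥ lift v = 0) (hx : x ∈ coneCell s) : a ⬝ᵥ x = 0 := by
  obtain ⟨c, -, -, rfl⟩ := mem_coneCell_iff.1 hx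
  rw [dotProduct_sum]
  exact Finset.sum_eq_zero fun v hv => by rw [dotProduct_smul, h v hv, smul_zero]

theorem span_lift_eq_top {s : Finset (Fin k → ℝ)}
    (h : AffineIndependent ℝ ((↑) : s → Fin k → ℝ)) (hs : s.card = k + 1) :
    Submodule.span ℝ (lift '' (s : Set (Fin k → ℝ))) = ⊤ := by
  have := (linearIndependent_lift h).span_eq_top_of_card_eq_finrank' (by simp [hs])
  rw [← this]
  congr 1
  ext x; simp

theorem interior_coneCell_nonempty {s : Finset (Fin k → ℝ)}
    (h : AffineIndependent ℝ ((↑) : s → Fin k → ℝ)) (hs : s.card = k + 1) :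
    (interior (coneCell s)).Nonempty := by
  rw [coneCell, interior_convexHull_nonempty_iff_affineSpan_eq_top]
  apply SetLike.coe_injective
  rw [affineSpan_insert_zero, span_lift_eq_top h hs]
  rfl

theorem mem_convexHull_iff_lift {s : Finset (Fin k → ℝ)} {y : Fin k → ℝ} :
    y ∈ convexHull ℝ (s : Set (Fin k → ℝ)) ↔ ∃ c : (Fin k → ℝ) → ℝ, (∀ v ∈ s, 0 ≤ c v) ∧
      lift y = ∑ v ∈ s, c v • lift v := by
  rw [Finset.mem_convexHull']
  constructor
  · rintro ⟨w, h1, h2, h3⟩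
    refine ⟨w, h1, ?_⟩
    ext i
    refine Fin.cases ?_ (fun j => ?_) i
    · simp [lift_zero, h2]
    · simpa [lift_succ] using (congrFun h3 j).symm
  · rintro ⟨w, h1, h2⟩
    refine ⟨w, h1, ?_, ?_⟩
    · simpa [lift_zero] using (congrFun h2 0).symm
    · ext j
      simpa [lift_succ] using (congrFun h2 j.succ).symm

-- Away from the apex, scaling to height 1 reduces the claim to the intersection property of the
-- complex.
open scoped Classical in
theorem coneCell_inter_subset {K : Geometry.SimplicialComplex ℝ (Fin k → ℝ)}
    {s t : Finset (Fin k → ℝ)} (hs : s ∈ K.faces) (ht : t ∈ K.faces) :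
    coneCell s ∩ coneCell t ⊆ coneCell (s ∩ t) := by
  rintro x ⟨hxs, hxt⟩
  obtain ⟨c, hc0, hc1, hc⟩ := mem_coneCell_iff.1 hxs
  obtain ⟨d, hd0, hd1, hd⟩ := mem_coneCell_iff.1 hxt
  have hx0 : x 0 = ∑ v ∈ s, c v := by rw [hc]; simp [lift_zero]
  have hx0' : x 0 = ∑ v ∈ t, d v := by rw [hd]; simp [lift_zero]
  -- At height zero all weights vanish and the point is the apex, which lies in the cone over `s ∩
  -- t` even if this intersection is empty.
  rcases (Finset.sum_nonneg hc0).eq_or_lt with h0 | hpos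
  · have h1 := (Finset.sum_eq_zero_iff_of_nonneg hc0).1 h0.symm
    refine mem_coneCell_iff.2 ⟨0, by simp, by simp, ?_⟩
    rw [hc]
    simpa using Finset.sum_eq_zero fun v hv => by rw [h1 v hv, zero_smul]
  · rw [← hx0] at hpos
    let y : Fin k → ℝ := fun i => x i.succ / x 0
    have hy : x = x 0 • lift y := by
      ext i
      refine Fin.cases ?_ (fun j => ?_) i
      · simp [lift_zero]
      · simp only [Pi.smul_apply, smul_eq_mul, lift_succ, y]; field_simp
    have hy' : lift y = (x 0)⁻¹ • x := by
      conv_rhs => rw [hy]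
      rw [smul_smul]; simp [lift_zero, hpos.ne']
    have h1 : y ∈ convexHull ℝ (s : Set (Fin k → ℝ)) :=
      mem_convexHull_iff_lift.2 ⟨fun v => (x 0)⁻¹ * c v, fun v hv => by
        have := hc0 v hv; positivity, by
        rw [hy']
        conv_lhs => arg 2; rw [hc]
        simp only [Finset.smul_sum, mul_smul]⟩
    have h2 : y ∈ convexHull ℝ (t : Set (Fin k → ℝ)) :=
      mem_convexHull_iff_lift.2 ⟨fun v => (x 0)⁻¹ * d v, fun v hv => by
        have := hd0 v hv; positivity, by
        rw [hy']
        conv_lhs => arg 2; rw [hd]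
        simp only [Finset.smul_sum, mul_smul]⟩
    have h3 := K.inter_subset_convexHull hs ht ⟨h1, h2⟩
    rw [← Finset.coe_inter] at h3
    obtain ⟨e, he0, he⟩ := mem_convexHull_iff_lift.1 h3
    refine mem_coneCell_iff.2 ⟨fun v => x 0 * e v, fun v hv => mul_nonneg hpos.le (he0 v hv), ?_, ?_⟩
    · have : ∑ v ∈ s ∩ t, e v = 1 := by
        have := congrFun he 0
        simpa [lift_zero] using this.symm
      rw [← Finset.mul_sum, this, mul_one, hx0]
      exact hc1
    · conv_lhs => rw [hy, he, Finset.smul_sum]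
      simp [mul_smul]

end Cones

/-! ### Splines as families of polynomials with matching jets. -/

section Splines

variable {k r : ℕ} {K : Geometry.SimplicialComplex ℝ (Fin k → ℝ)}

theorem uniqueDiffOn_coneCell {s : Finset (Fin k → ℝ)} (hs : s ∈ cells K) :
    UniqueDiffOn ℝ (coneCell s) :=
  uniqueDiffOn_convex (convex_coneCell s) (interior_coneCell_nonempty (K.indep hs.1) hs.2)

theorem coneCell_subset_coneSpace {s : Finset (Fin k → ℝ)} (hs : s ∈ cells K) :
    coneCell s ⊆ coneSpace K := Set.subset_biUnion_of_mem (u := fun s => coneCell s) hs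

theorem hasFDerivWithinAt_biUnion {ι E F : Type*} [NormedAddCommGroup E] [NormedSpace ℝ E]
    [NormedAddCommGroup F] [NormedSpace ℝ F] {I : Set ι} (hI : I.Finite) {S : ι → Set E}
    {f : E → F} {f' : E →L[ℝ] F} {x : E} (h : ∀ i ∈ I, HasFDerivWithinAt f f' (S i) x) :
    HasFDerivWithinAt f f' (⋃ i ∈ I, S i) x := by
  induction I, hI using Set.Finite.induction_on with
  | empty => simp
  | insert _ _ ih =>
    rw [Set.biUnion_insert]
    exact (h _ (Set.mem_insert _ _)).union (ih fun i hi => h i (Set.mem_insert_of_mem _ hi))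

/-- The pieces of a spline have the same derivatives up to order `r` at common points. -/
theorem vanishesAt_of_mem_splines {f : cells K → PolyRing k} (hf : f ∈ splines r K)
    (s t : cells K) {x : Fin (k + 1) → ℝ} (hs : x ∈ coneCell s.1) (ht : x ∈ coneCell t.1) :
    VanishesAt r (f s - f t) x := by
  obtain ⟨F, hF, hFf⟩ := hf
  have hx := coneCell_subset_coneSpace s.2 hs
  -- A local Taylor series of `F` restricts to each cell through `x`. Cells have unique derivatives,
  -- so its terms at `x` are the derivatives of every piece through `x`.
  obtain ⟨u, hu, p, hp⟩ := contDiffWithinAt_nat.1 (hF x hx)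
  rw [Set.insert_eq_of_mem hx, mem_nhdsWithin] at hu
  obtain ⟨V, hV, hxV, hVu⟩ := hu
  have key : ∀ q : cells K, x ∈ coneCell q.1 → ∀ m ≤ r,
      p x m = iteratedFDeriv ℝ m (fun y => eval y (f q)) x := by
    intro q hq m hm
    have hud : UniqueDiffOn ℝ (coneCell q.1 ∩ V) := (uniqueDiffOn_coneCell q.2).inter hV
    have hsub : coneCell q.1 ∩ V ⊆ u := fun y hy =>
      hVu ⟨hy.2, coneCell_subset_coneSpace q.2 hy.1⟩
    rw [(hp.mono hsub).eq_iteratedFDerivWithin_of_uniqueDiffOn (by exact_mod_cast hm) hud ⟨hq, hxV⟩,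
      ← iteratedFDerivWithin_eq_iteratedFDeriv hud (contDiff_eval (f q)).contDiffAt ⟨hq, hxV⟩]
    exact iteratedFDerivWithin_congr (s := coneCell q.1 ∩ V) (fun y hy => hFf q y hy.1)
      ⟨hq, hxV⟩ m
  exact vanishesAt_sub_iff.2 fun m hm => by rw [← key s hs m hm, ← key t ht m hm]

/-- Replaces the `C^r` condition by conditions on pairs of pieces. Conversely, matching jets define
one Taylor series on the union, and its differentiability and continuity are checked on the finitely
many closed cells. -/
theorem mem_splines_iff (hK : K.faces.Finite) {f : cells K → PolyRing k} :
    f ∈ splines r K ↔ ∀ s t : cells K, ∀ x ∈ coneCell s.1, x ∈ coneCell t.1 →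
      VanishesAt r (f s - f t) x := by
  classical
  refine ⟨fun hf s t x hs ht => vanishesAt_of_mem_splines hf s t hs ht, fun h => ?_⟩
  -- The cell through `x` is chosen arbitrarily; up to order `r` the choice does not matter. The
  -- value 0 off the cone space is never used.
  let p : (Fin (k + 1) → ℝ) → FormalMultilinearSeries ℝ (Fin (k + 1) → ℝ) ℝ := fun x =>
    if hx : ∃ s : cells K, x ∈ coneCell s.1 then
      ftaylorSeries ℝ (fun y => eval y (f hx.choose)) x else 0
  have hp : ∀ s : cells K, ∀ x ∈ coneCell s.1, ∀ m ≤ r,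
      p x m = iteratedFDeriv ℝ m (fun y => eval y (f s)) x := by
    intro s x hs m hm
    have hx : ∃ s : cells K, x ∈ coneCell s.1 := ⟨s, hs⟩
    simp only [p, dif_pos hx]
    exact vanishesAt_sub_iff.1 (h hx.choose s x hx.choose_spec hs) m hm
  have hp0 : ∀ s : cells K, ∀ x ∈ coneCell s.1, (p x 0).curry0 = eval x (f s) := by
    intro s x hs
    rw [hp s x hs 0 (Nat.zero_le _)]
    simp [ContinuousMultilinearMap.curry0]
  have hfin : (cells K).Finite := hK.subset fun s hs => hs.1
  refine ⟨fun x => (p x 0).curry0, ?_, hp0⟩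
  have hT : HasFTaylorSeriesUpToOn (r : ℕ∞) (fun x => (p x 0).curry0) p (coneSpace K) := by
    have hpoly : ∀ s : cells K, HasFTaylorSeriesUpToOn (r : ℕ∞) (fun y => eval y (f s))
        (ftaylorSeries ℝ fun y => eval y (f s)) (coneCell s.1) := fun s =>
      ((contDiff_eval (n := (r : ℕ∞)) (f s)).ftaylorSeries).hasFTaylorSeriesUpToOn _
    refine ⟨fun _ _ => rfl, fun m hm x _ => ?_, fun m hm x _ => ?_⟩
    · have hm' : m < r := by exact_mod_cast hm
      have : ∀ s ∈ cells K, HasFDerivWithinAt (p · m) (p x m.succ).curryLeft (coneCell s) x := by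
        intro s hs
        by_cases hx : x ∈ coneCell s
        · rw [hp ⟨s, hs⟩ x hx m.succ hm']
          exact ((hpoly ⟨s, hs⟩).fderivWithin m hm x hx).congr
            (fun y hy => hp ⟨s, hs⟩ y hy m hm'.le) (hp ⟨s, hs⟩ x hx m hm'.le)
        · refine HasFDerivWithinAt.of_notMem_closure ?_
          rwa [(isClosed_coneCell s).closure_eq]
      exact hasFDerivWithinAt_biUnion hfin this
    · have hm' : m ≤ r := by exact_mod_cast hm
      rw [ContinuousWithinAt, coneSpace, nhdsWithin_biUnion hfin, Filter.tendsto_iSup]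
      intro s
      rw [Filter.tendsto_iSup]
      intro hs
      by_cases hx : x ∈ coneCell s
      · exact (((hpoly ⟨s, hs⟩).cont m hm).congr
          (fun y hy => hp ⟨s, hs⟩ y hy m hm')) x hx
      · exact continuousWithinAt_of_notMem_closure (by rwa [(isClosed_coneCell s).closure_eq])
  exact hT.contDiffOn

end Splines

/-! ### Normals of facets, and divisibility by powers of facet forms. -/

section Normals

variable {k : ℕ}

theorem exists_ne_zero_dotProduct_eq_zero (S : Finset (Fin (k + 1) → ℝ)) (hS : S.card ≤ k) :
    ∃ a : Fin (k + 1) → ℝ, a ≠ 0 ∧ ∀ v ∈ S, a ⬝ᵥ v = 0 := by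
  let φ : (Fin (k + 1) → ℝ) →ₗ[ℝ] (S → ℝ) := Matrix.mulVecLin (Matrix.of fun v : S => v.1)
  have h : LinearMap.ker φ ≠ ⊥ := by
    apply LinearMap.ker_ne_bot_of_finrank_lt
    simp only [finrank_fintype_fun_eq_card, Fintype.card_coe, Fintype.card_fin]
    omega
  obtain ⟨a, ha, ha0⟩ := (Submodule.ne_bot_iff _).1 h
  refine ⟨a, ha0, fun v hv => ?_⟩
  have := congrFun (LinearMap.mem_ker.1 ha) ⟨v, hv⟩
  rw [dotProduct_comm]
  simpa [φ, Matrix.mulVec] using this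

theorem exists_normal {τ : Finset (Fin k → ℝ)} (h : τ.card ≤ k) :
    ∃ a : Fin (k + 1) → ℝ, a ≠ 0 ∧ ∀ v ∈ τ, a ⬝ᵥ lift v = 0 := by
  classical
  obtain ⟨a, ha, h1⟩ := exists_ne_zero_dotProduct_eq_zero (τ.image lift)
    (Finset.card_image_le.trans h)
  exact ⟨a, ha, fun v hv => h1 _ (Finset.mem_image_of_mem _ hv)⟩

/-- The second normal is also taken orthogonal to the first one, which makes the two independent. -/
theorem exists_two_normals {τ : Finset (Fin k → ℝ)} (h : τ.card < k) :
    ∃ a b : Fin (k + 1) → ℝ, LinearIndependent ℝ ![a, b] ∧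
      ∀ v ∈ τ, a ⬝ᵥ lift v = 0 ∧ b ⬝ᵥ lift v = 0 := by
  classical
  obtain ⟨a, ha, h1⟩ := exists_normal h.le
  obtain ⟨b, hb, h2⟩ := exists_ne_zero_dotProduct_eq_zero (insert a (τ.image lift))
    ((Finset.card_insert_le _ _).trans (Nat.succ_le_of_lt (Finset.card_image_le.trans_lt h)))
  refine ⟨a, b, (LinearIndependent.pair_iff' ha).2 fun c hc => ?_, fun v hv => ⟨h1 v hv,
    h2 _ (Finset.mem_insert_of_mem (Finset.mem_image_of_mem _ hv))⟩⟩
  have h3 := h2 a (Finset.mem_insert_self _ _)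
  rw [← hc, smul_dotProduct, smul_eq_mul, mul_eq_zero, dotProduct_self_eq_zero] at h3
  rcases h3 with rfl | h3
  · exact hb (by rw [← hc, zero_smul])
  · exact ha h3

open scoped Classical in
/-- A nonzero coefficient vector of a linear form vanishing on the lifted vertices of `τ`. -/
def normal (τ : Finset (Fin k → ℝ)) : Fin (k + 1) → ℝ :=
  if h : ∃ a : Fin (k + 1) → ℝ, a ≠ 0 ∧ ∀ v ∈ τ, a ⬝ᵥ lift v = 0 then h.choose else 0

theorem normal_ne_zero {τ : Finset (Fin k → ℝ)} (h : τ.card = k) : normal τ ≠ 0 := by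
  have h' := exists_normal h.le
  rw [normal, dif_pos h']
  exact h'.choose_spec.1

theorem normal_dotProduct {τ : Finset (Fin k → ℝ)} (h : τ.card = k) {v : Fin k → ℝ}
    (hv : v ∈ τ) : normal τ ⬝ᵥ lift v = 0 := by
  have h' := exists_normal h.le
  rw [normal, dif_pos h']
  exact h'.choose_spec.2 v hv

theorem mem_span_lift_iff {τ : Finset (Fin k → ℝ)}
    (hτ : AffineIndependent ℝ ((↑) : τ → Fin k → ℝ)) (h : τ.card = k) (x : Fin (k + 1) → ℝ) :
    x ∈ Submodule.span ℝ (lift '' (τ : Set (Fin k → ℝ))) ↔ normal τ ⬝ᵥ x = 0 := by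
  let φ : (Fin (k + 1) → ℝ) →ₗ[ℝ] ℝ := dotProductBilin ℝ ℝ (normal τ)
  have hφ : ∀ x, φ x = normal τ ⬝ᵥ x := fun x => rfl
  have hle : Submodule.span ℝ (lift '' (τ : Set (Fin k → ℝ))) ≤ LinearMap.ker φ := by
    rw [Submodule.span_le]
    rintro _ ⟨v, hv, rfl⟩
    exact normal_dotProduct h hv
  have h1 : finrank ℝ (Submodule.span ℝ (lift '' (τ : Set (Fin k → ℝ)))) = k := by
    have := finrank_span_eq_card (linearIndependent_lift hτ)
    rw [Fintype.card_coe, h] at this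
    have h3 : Set.range (fun v : τ => lift v.1) = lift '' (τ : Set (Fin k → ℝ)) := by ext; simp
    rwa [h3] at this
  have h2 : finrank ℝ (LinearMap.ker φ) ≤ k := by
    have hne : LinearMap.ker φ ≠ ⊤ := by
      intro htop
      have : normal τ ∈ LinearMap.ker φ := by rw [htop]; trivial
      rw [LinearMap.mem_ker, hφ, dotProduct_self_eq_zero] at this
      exact normal_ne_zero h this
    have := Submodule.finrank_lt hne
    simp only [finrank_fintype_fun_eq_card, Fintype.card_fin] at this
    omega
  rw [Submodule.eq_of_le_of_finrank_le hle (by rw [h1]; exact h2), LinearMap.mem_ker, hφ]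

/-- A polynomial vanishing on the cone over a simplex vanishes on its linear span. -/
theorem eval_eq_zero_of_mem_span {τ : Finset (Fin k → ℝ)} {p : PolyRing k}
    (hp : ∀ x ∈ coneCell τ, eval x p = 0) {x : Fin (k + 1) → ℝ}
    (hx : x ∈ Submodule.span ℝ (lift '' (τ : Set (Fin k → ℝ)))) : eval x p = 0 := by
  let P : MvPolynomial τ ℝ :=
    (aeval fun i => ∑ v : τ, C (lift v.1 i) * X v : PolyRing k →ₐ[ℝ] MvPolynomial τ ℝ) p
  have hP : ∀ c : τ → ℝ, eval c P = eval (∑ v : τ, c v • lift v.1) p := by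
    intro c
    have : (aeval c : MvPolynomial τ ℝ →ₐ[ℝ] ℝ).comp
        (aeval fun i => ∑ v : τ, C (lift v.1 i) * X v : PolyRing k →ₐ[ℝ] MvPolynomial τ ℝ)
        = aeval (∑ v : τ, c v • lift v.1) := by
      apply MvPolynomial.algHom_ext
      intro i
      simp only [AlgHom.comp_apply, aeval_X, map_sum, map_mul, algHom_C, Finset.sum_apply,
        Pi.smul_apply, smul_eq_mul]
      exact Finset.sum_congr rfl fun v _ => mul_comm _ _
    have := DFunLike.congr_fun this p
    rwa [AlgHom.comp_apply, aeval_eq_eval, aeval_eq_eval] at this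
  have h0 : P = 0 := by
    -- The bound on the coefficients keeps their sum at most 1, so the whole box maps into the cone;
    -- a polynomial vanishing on a product of infinite sets is zero.
    refine MvPolynomial.funext_set (fun _ => Set.Icc (0 : ℝ) (1 / (τ.card + 1)))
      (fun _ => Set.Icc_infinite (by positivity)) fun c hc => ?_
    rw [hP, map_zero]
    apply hp
    rw [mem_coneCell_iff]
    classical
    refine ⟨fun v => if h : v ∈ τ then c ⟨v, h⟩ else 0, fun v hv => ?_, ?_, ?_⟩
    · simp only [dif_pos hv]
      exact (hc ⟨v, hv⟩ trivial).1
    · calc ∑ v ∈ τ, (if h : v ∈ τ then c ⟨v, h⟩ else 0)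
          ≤ ∑ v ∈ τ, (1 / (τ.card + 1) : ℝ) := Finset.sum_le_sum fun v hv => by
            simp only [dif_pos hv]; exact (hc ⟨v, hv⟩ trivial).2
        _ ≤ 1 := by
            rw [Finset.sum_const, nsmul_eq_mul, mul_one_div, div_le_one (by positivity)]
            linarith
    · rw [← Finset.sum_coe_sort τ]
      exact Finset.sum_congr rfl fun v _ => by simp
  have : Set.range (fun v : τ => lift v.1) = lift '' (τ : Set (Fin k → ℝ)) := by ext; simp
  rw [← this, Submodule.mem_span_range_iff_exists_fun] at hx
  obtain ⟨c, rfl⟩ := hx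
  rw [← hP, h0, map_zero]

/-- A polynomial vanishing to order `r` along a `(k-1)`-simplex is divisible by the `(r+1)`-st
power of the linear form of this simplex. -/
theorem form_normal_pow_dvd {r : ℕ} {τ : Finset (Fin k → ℝ)}
    (hτ : AffineIndependent ℝ ((↑) : τ → Fin k → ℝ)) (h : τ.card = k) {p : PolyRing k}
    (hp : ∀ x ∈ coneCell τ, VanishesAt r p x) : form (normal τ) ^ (r + 1) ∣ p := by
  -- One factor is split off at a time: after `m ≤ r` of them, the cofactor still vanishes on the
  -- cone, hence on the hyperplane it spans.
  have key : ∀ m ≤ r + 1, form (normal τ) ^ m ∣ p := by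
    intro m
    induction m with
    | zero => simp
    | succ m ih =>
      intro hm
      obtain ⟨q, rfl⟩ := ih (by omega)
      rw [pow_succ]
      refine mul_dvd_mul_left _ (form_dvd_of_eval_eq_zero (normal_ne_zero h) fun x hx => ?_)
      rw [← mem_span_lift_iff hτ h] at hx
      refine eval_eq_zero_of_mem_span (fun y hy => ?_) hx
      exact eval_eq_zero_of_vanishesAt (by omega) (normal_ne_zero h)
        (dotProduct_eq_zero_of_mem_coneCell (fun v hv => normal_dotProduct h hv) hy) (hp y hy)
  exact key _ le_rfl

/-- The generators of `faceIdeal` come from arbitrary linear forms vanishing on a facet, the zero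
form included. This relates them to the chosen normal. -/
theorem form_normal_dvd {τ : Finset (Fin k → ℝ)}
    (hτ : AffineIndependent ℝ ((↑) : τ → Fin k → ℝ)) (h : τ.card = k) {l : PolyRing k}
    (hl : l.IsHomogeneous 1) (hv : ∀ v ∈ τ, eval (lift v) l = 0) : form (normal τ) ∣ l := by
  obtain ⟨c, rfl⟩ : ∃ c, form c = l := by
    have h1 := (mem_homogeneousSubmodule 1 l).2 hl
    rw [homogeneousSubmodule_one_eq_span_X, Submodule.mem_span_range_iff_exists_fun] at h1
    simpa only [form, smul_eq_C_mul] using h1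
  refine form_dvd_of_eval_eq_zero (normal_ne_zero h) fun x hx => ?_
  rw [← mem_span_lift_iff hτ h] at hx
  simp only [eval_form] at hv ⊢
  induction hx using Submodule.span_induction with
  | mem x hx => obtain ⟨v, hvτ, rfl⟩ := hx; exact hv v hvτ
  | zero => simp
  | add x y _ _ hx hy => rw [dotProduct_add, hx, hy, add_zero]
  | smul c x _ hx => rw [dotProduct_smul, hx, smul_zero]

end Normals

/-! ### Barycentric coordinates. -/

section Simplices

variable {k : ℕ}

open scoped Classical in
theorem exists_coordinates {s : Finset (Fin k → ℝ)}
    (h : AffineIndependent ℝ ((↑) : s → Fin k → ℝ)) (hs : s.card = k + 1) :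
    ∃ e : (Fin k → ℝ) → Fin (k + 1) → ℝ,
      (∀ v ∈ s, ∀ w ∈ s, e v ⬝ᵥ lift w = if v = w then 1 else 0) ∧
      ∀ x, x = ∑ v ∈ s, (e v ⬝ᵥ x) • lift v := by
  obtain ⟨e, he⟩ := exists_dual_family (linearIndependent_lift h)
  have h1 : ∀ v ∈ s, ∀ w ∈ s, (if hv : v ∈ s then e ⟨v, hv⟩ else 0) ⬝ᵥ lift w
      = if v = w then 1 else 0 := by
    intro v hv w hw
    rw [dif_pos hv, dotProduct_comm, he ⟨w, hw⟩ ⟨v, hv⟩]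
    simp [eq_comm]
  refine ⟨fun v => if hv : v ∈ s then e ⟨v, hv⟩ else 0, h1, fun x => ?_⟩
  have hx : x ∈ Submodule.span ℝ (lift '' (s : Set (Fin k → ℝ))) := by
    rw [span_lift_eq_top h hs]; trivial
  induction hx using Submodule.span_induction with
  | mem x hx =>
    obtain ⟨w, hw, rfl⟩ := hx
    rw [Finset.sum_eq_single_of_mem w hw fun v hv hvw => by
      rw [h1 v hv w hw, if_neg hvw, zero_smul], h1 w hw w hw, if_pos rfl, one_smul]
  | zero => simp
  | add x y _ _ hx hy =>
    conv_lhs => rw [hx, hy]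
    simp only [dotProduct_add, add_smul, Finset.sum_add_distrib]
  | smul c x _ hx =>
    conv_lhs => rw [hx]
    simp only [dotProduct_smul, Finset.smul_sum, smul_assoc]

open scoped Classical in
theorem coordinate_sum {s : Finset (Fin k → ℝ)} {e : (Fin k → ℝ) → Fin (k + 1) → ℝ}
    (he : ∀ v ∈ s, ∀ w ∈ s, e v ⬝ᵥ lift w = if v = w then 1 else 0)
    {τ : Finset (Fin k → ℝ)} (hτ : τ ⊆ s) (c : (Fin k → ℝ) → ℝ) {v : Fin k → ℝ} (hv : v ∈ s) :
    e v ⬝ᵥ (∑ w ∈ τ, c w • lift w) = if v ∈ τ then c v else 0 := by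
  rw [dotProduct_sum, Finset.sum_congr rfl fun w hw => by
    rw [dotProduct_smul, he v hv w (hτ hw)]]
  simp

open scoped Classical in
theorem mem_convexHull_iff_coordinates {s : Finset (Fin k → ℝ)}
    {e : (Fin k → ℝ) → Fin (k + 1) → ℝ}
    (he : ∀ v ∈ s, ∀ w ∈ s, e v ⬝ᵥ lift w = if v = w then 1 else 0)
    (he' : ∀ x, x = ∑ v ∈ s, (e v ⬝ᵥ x) • lift v) {y : Fin k → ℝ} :
    y ∈ convexHull ℝ (s : Set (Fin k → ℝ)) ↔ ∀ v ∈ s, 0 ≤ e v ⬝ᵥ lift y := by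
  rw [mem_convexHull_iff_lift]
  constructor
  · rintro ⟨c, h0, hc⟩ v hv
    rw [hc, coordinate_sum he subset_rfl c hv, if_pos hv]
    exact h0 v hv
  · exact fun h => ⟨_, h, he' _⟩

theorem lift_lineMap (x z : Fin k → ℝ) (ε : ℝ) :
    lift (x + ε • (z - x)) = lift x + ε • (lift z - lift x) := by
  ext i
  refine Fin.cases ?_ (fun j => ?_) i
  · simp [lift_zero]
  · simp [lift_succ]

/-- Otherwise the normal would be orthogonal to all lifted vertices of `s`, which span the space,
and so to itself. -/
theorem normal_dotProduct_ne_zero {s τ : Finset (Fin k → ℝ)}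
    (h : AffineIndependent ℝ ((↑) : s → Fin k → ℝ)) (hs : s.card = k + 1) (hτ : τ ⊆ s)
    (hc : τ.card = k) {v : Fin k → ℝ} (hv : v ∈ s) (hvτ : v ∉ τ) :
    normal τ ⬝ᵥ lift v ≠ 0 := by
  classical
  intro h0
  have hins : insert v τ = s := Finset.eq_of_subset_of_card_le
    (Finset.insert_subset hv hτ) (by rw [Finset.card_insert_of_notMem hvτ]; omega)
  obtain ⟨e, -, he⟩ := exists_coordinates h hs
  apply normal_ne_zero hc
  rw [← dotProduct_self_eq_zero]
  conv_lhs => arg 2; rw [he (normal τ)]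
  rw [dotProduct_sum]
  refine Finset.sum_eq_zero fun w hw => ?_
  rw [dotProduct_smul]
  rw [← hins, Finset.mem_insert] at hw
  rcases hw with rfl | hw
  · rw [h0, smul_zero]
  · rw [normal_dotProduct hc hw, smul_zero]

open scoped Classical in
/-- Near a relative interior point of a facet of a simplex, the simplex contains all points on its
side of the facet. -/
theorem eventually_mem_convexHull {s τ : Finset (Fin k → ℝ)}
    (h : AffineIndependent ℝ ((↑) : s → Fin k → ℝ)) (hs : s.card = k + 1) (hτ : τ ⊆ s)
    (hc : τ.card = k) {v : Fin k → ℝ} (hv : v ∈ s) (hvτ : v ∉ τ) {x z : Fin k → ℝ}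
    {c : (Fin k → ℝ) → ℝ} (hc0 : ∀ w ∈ τ, 0 < c w) (hx : lift x = ∑ w ∈ τ, c w • lift w)
    (hz : 0 < (normal τ ⬝ᵥ lift z) * (normal τ ⬝ᵥ lift v)) :
    ∀ᶠ ε in 𝓝[>] (0 : ℝ), x + ε • (z - x) ∈ convexHull ℝ (s : Set (Fin k → ℝ)) := by
  obtain ⟨e, he, he'⟩ := exists_coordinates h hs
  simp only [mem_convexHull_iff_coordinates he he', lift_lineMap]
  change ∀ᶠ ε : ℝ in 𝓝[>] 0, ∀ v ∈ (s : Set (Fin k → ℝ)), _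
  rw [eventually_all_finite s.finite_toSet]
  -- Coordinates at the vertices of `τ` are positive at `x` and stay so for small `ε`. The
  -- coordinate at `v` is zero at `x`, and `hz` makes it positive at `z`.
  intro w hw
  by_cases hwτ : w ∈ τ
  · have h1 : Tendsto (fun ε : ℝ => e w ⬝ᵥ (lift x + ε • (lift z - lift x))) (𝓝 0)
        (𝓝 (e w ⬝ᵥ (lift x + (0 : ℝ) • (lift z - lift x)))) := by
      simp only [dotProduct_add, dotProduct_smul, smul_eq_mul]
      exact (Continuous.tendsto (by fun_prop) 0)
    have h2 : 0 < e w ⬝ᵥ (lift x + (0 : ℝ) • (lift z - lift x)) := by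
      rw [zero_smul, add_zero, hx, coordinate_sum he hτ c hw, if_pos hwτ]
      exact hc0 w hwτ
    exact ((h1.eventually (lt_mem_nhds h2)).filter_mono nhdsWithin_le_nhds).mono
      fun ε hε => hε.le
  · have hins : insert v τ = s := Finset.eq_of_subset_of_card_le
      (Finset.insert_subset hv hτ) (by rw [Finset.card_insert_of_notMem hvτ]; omega)
    obtain rfl : w = v := by
      have hw' : w ∈ s := hw
      rw [← hins, Finset.mem_insert] at hw'
      exact hw'.resolve_right hwτ
    have h1 : normal τ ⬝ᵥ lift z = (e w ⬝ᵥ lift z) * (normal τ ⬝ᵥ lift w) := by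
      conv_lhs => rw [he' (lift z), dotProduct_sum]
      rw [Finset.sum_eq_single_of_mem w hv fun u hu huw => ?_, dotProduct_smul, smul_eq_mul]
      rw [← hins, Finset.mem_insert] at hu
      rw [dotProduct_smul, normal_dotProduct hc (hu.resolve_left huw), smul_zero]
    have h2 : 0 ≤ e w ⬝ᵥ lift z := by
      rw [h1, mul_assoc] at hz
      exact (pos_of_mul_pos_left hz (mul_self_nonneg _)).le
    filter_upwards [self_mem_nhdsWithin] with ε hε
    have hε' : (0 : ℝ) < ε := hε
    rw [dotProduct_add, dotProduct_smul, dotProduct_sub, hx, coordinate_sum he hτ c hw,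
      if_neg hwτ, smul_eq_mul]
    nlinarith

theorem exists_barycenter {τ : Finset (Fin k → ℝ)} (hτ : τ.Nonempty) :
    ∃ x : Fin k → ℝ, ∃ c : ℝ, 0 < c ∧ lift x = ∑ w ∈ τ, c • lift w := by
  have hc : (0 : ℝ) < τ.card := by exact_mod_cast hτ.card_pos
  refine ⟨∑ w ∈ τ, (τ.card : ℝ)⁻¹ • w, (τ.card : ℝ)⁻¹, by positivity, ?_⟩
  ext i
  refine Fin.cases ?_ (fun j => ?_) i
  · simp [lift_zero, hc.ne']
  · simp [lift_succ]

end Simplices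

/-! ### Local geometry of simplicial complexes. -/

section Complexes

variable {k : ℕ} {K : Geometry.SimplicialComplex ℝ (Fin k → ℝ)}

open scoped Classical

theorem inter_eq_of_ne {s t τ : Finset (Fin k → ℝ)} (hs : s.card = k + 1) (ht : t.card = k + 1)
    (hst : s ≠ t) (h1 : τ ⊆ s) (h2 : τ ⊆ t) (hτ : τ.card = k) : s ∩ t = τ := by
  refine (Finset.eq_of_subset_of_card_le (Finset.subset_inter h1 h2) ?_).symm
  by_contra hlt
  push Not at hlt
  have h3 : (s ∩ t).card ≤ s.card := Finset.card_le_card Finset.inter_subset_left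
  have h4 := Finset.eq_of_subset_of_card_le (Finset.inter_subset_left (s₁ := s) (s₂ := t))
    (by omega)
  have h5 := Finset.eq_of_subset_of_card_le (Finset.inter_subset_right (s₁ := s) (s₂ := t))
    (by omega)
  exact hst (h4.symm.trans h5)

/-- Adjacent cells lie on different sides of their common facet. -/
theorem normal_mul_neg {s t : Finset (Fin k → ℝ)} (hs : s ∈ cells K) (ht : t ∈ cells K)
    (hst : (s ∩ t).card = k) {v w : Fin k → ℝ} (hv : v ∈ s) (hvt : v ∉ t) (hw : w ∈ t)
    (hws : w ∉ s) :
    (normal (s ∩ t) ⬝ᵥ lift v) * (normal (s ∩ t) ⬝ᵥ lift w) < 0 := by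
  have hv0 := normal_dotProduct_ne_zero (K.indep hs.1) hs.2 Finset.inter_subset_left hst hv
    (fun h => hvt (Finset.mem_inter.1 h).2)
  have hw0 := normal_dotProduct_ne_zero (K.indep ht.1) ht.2 Finset.inter_subset_right hst hw
    (fun h => hws (Finset.mem_inter.1 h).1)
  by_contra hlt
  push Not at hlt
  have hpos := lt_of_le_of_ne hlt (mul_ne_zero hv0 hw0).symm
  have hne : (s ∩ t).Nonempty := by
    rw [← Finset.card_pos, hst]
    rcases Nat.eq_zero_or_pos k with rfl | hk
    · exact absurd (Subsingleton.elim v w ▸ hw) hvt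
    · exact hk
  -- If `v` and `w` were on the same side, a small step from the barycenter of the common facet
  -- towards `v` would stay in both cells but leave the hyperplane of their intersection.
  obtain ⟨x, c, hc, hx⟩ := exists_barycenter hne
  have h1 := eventually_mem_convexHull (K.indep ht.1) ht.2 Finset.inter_subset_right hst hw
    (fun h => hws (Finset.mem_inter.1 h).1) (fun _ _ => hc) hx hpos
  have h2 : ∀ᶠ ε in 𝓝[>] (0 : ℝ), ε ∈ Set.Ioo (0 : ℝ) 1 := Ioo_mem_nhdsGT one_pos
  obtain ⟨ε, h3, h4⟩ := (h1.and h2).exists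
  have hxs : x ∈ convexHull ℝ (s : Set (Fin k → ℝ)) :=
    convexHull_mono (by simp) (mem_convexHull_iff_lift.2 ⟨fun _ => c, fun _ _ => hc.le, hx⟩)
  have h5 : x + ε • (v - x) ∈ convexHull ℝ (s : Set (Fin k → ℝ)) :=
    (convex_convexHull ℝ _).add_smul_sub_mem hxs (subset_convexHull ℝ _ hv) ⟨h4.1.le, h4.2.le⟩
  have h6 := K.inter_subset_convexHull hs.1 ht.1 ⟨h5, h3⟩
  rw [← Finset.coe_inter] at h6
  obtain ⟨d, -, hd⟩ := mem_convexHull_iff_lift.1 h6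
  have h7 : ∀ d : (Fin k → ℝ) → ℝ, normal (s ∩ t) ⬝ᵥ ∑ u ∈ s ∩ t, d u • lift u = 0 := fun d => by
    rw [dotProduct_sum]
    exact Finset.sum_eq_zero fun u hu => by
      rw [dotProduct_smul, normal_dotProduct hst hu, smul_zero]
  have h8 := h7 d
  rw [← hd, lift_lineMap, dotProduct_add, dotProduct_smul, dotProduct_sub, hx, h7 fun _ => c] at h8
  simp only [smul_eq_mul, zero_add, sub_zero, mul_eq_zero] at h8
  exact h8.elim h4.1.ne' hv0

/-- A `(k-1)`-face is contained in at most two cells. -/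
theorem eq_of_facet_subset {s t q τ : Finset (Fin k → ℝ)} (hs : s ∈ cells K) (ht : t ∈ cells K)
    (hq : q ∈ cells K) (hτ : τ.card = k) (h1 : τ ⊆ s) (h2 : τ ⊆ t) (h3 : τ ⊆ q) (hst : s ≠ t)
    (hsq : s ≠ q) : t = q := by
  by_contra htq
  have e1 := inter_eq_of_ne hs.2 ht.2 hst h1 h2 hτ
  have e2 := inter_eq_of_ne hs.2 hq.2 hsq h1 h3 hτ
  have e3 := inter_eq_of_ne ht.2 hq.2 htq h2 h3 hτ
  have hex : ∀ u ∈ cells K, ∃ v ∈ u, v ∉ τ := fun u hu => by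
    by_contra hcon
    push Not at hcon
    have h := Finset.card_le_card hcon
    rw [hτ, hu.2] at h
    omega
  obtain ⟨a, ha, haτ⟩ := hex s hs
  obtain ⟨b, hb, hbτ⟩ := hex t ht
  obtain ⟨c, hc, hcτ⟩ := hex q hq
  have hn : ∀ {u u' : Finset (Fin k → ℝ)} {v : Fin k → ℝ}, u ∩ u' = τ → v ∈ u → v ∉ τ → v ∉ u' :=
    fun h hv hvτ hv' => hvτ (h ▸ Finset.mem_inter.2 ⟨hv, hv'⟩)
  have f1 := normal_mul_neg hs ht (e1 ▸ hτ) ha (hn e1 ha haτ) hb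
    (hn (Finset.inter_comm s t ▸ e1) hb hbτ)
  have f2 := normal_mul_neg hs hq (e2 ▸ hτ) ha (hn e2 ha haτ) hc
    (hn (Finset.inter_comm s q ▸ e2) hc hcτ)
  have f3 := normal_mul_neg ht hq (e3 ▸ hτ) hb (hn e3 hb hbτ) hc
    (hn (Finset.inter_comm t q ▸ e3) hc hcτ)
  -- Three real numbers cannot have pairwise negative products.
  rw [e1] at f1; rw [e2] at f2; rw [e3] at f3
  nlinarith [mul_pos_of_neg_of_neg f1 f2,
    mul_nonneg (sq_nonneg (normal τ ⬝ᵥ lift a)) (neg_pos.2 f3).le]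

theorem card_le_of_mem_faces {s : Finset (Fin k → ℝ)} (hs : s ∈ K.faces) : s.card ≤ k + 1 := by
  simpa using (linearIndependent_lift (K.indep hs)).fintype_card_le_finrank

/-- A face containing a relative interior point of another face contains this face. -/
theorem subset_of_barycenter_mem {ρ τ : Finset (Fin k → ℝ)} (hρ : ρ ∈ K.faces) (hτ : τ ∈ K.faces)
    {x : Fin k → ℝ} {c : ℝ} (hc : 0 < c) (hx : lift x = ∑ w ∈ τ, c • lift w)
    (hxρ : x ∈ convexHull ℝ (ρ : Set (Fin k → ℝ))) : τ ⊆ ρ := by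
  have hxτ : x ∈ convexHull ℝ (τ : Set (Fin k → ℝ)) :=
    mem_convexHull_iff_lift.2 ⟨fun _ => c, fun _ _ => hc.le, hx⟩
  have h6 := K.inter_subset_convexHull hρ hτ ⟨hxρ, hxτ⟩
  rw [← Finset.coe_inter] at h6
  obtain ⟨d, -, hd⟩ := mem_convexHull_iff_lift.1 h6
  intro w hw
  by_contra hwρ
  have hli := linearIndependent_lift (K.indep hτ)
  rw [Fintype.linearIndependent_iff] at hli
  -- Two expansions of `lift x` in the independent lifts of `τ` are compared; a vertex outside `ρ`
  -- would have weight both `c` and 0.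
  have h7 : ∑ v : τ, (c - if v.1 ∈ ρ then d v.1 else 0) • lift v.1 = 0 := by
    rw [Finset.sum_coe_sort τ fun v => (c - if v ∈ ρ then d v else 0) • lift v]
    simp only [sub_smul, Finset.sum_sub_distrib]
    rw [← hx, hd, sub_eq_zero, Finset.inter_comm, ← Finset.filter_mem_eq_inter, Finset.sum_filter]
    exact Finset.sum_congr rfl fun v _ => by split_ifs <;> simp
  have h8 := hli _ h7 ⟨w, hw⟩
  simp only [if_neg hwρ, sub_zero] at h8
  exact hc.ne' h8

/-- In a subdivision of a simplex, a `(k-1)`-face contained in only one cell lies in a facet of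
the simplex. -/
theorem exists_facet_of_unique_cell (hK : K.faces.Finite) {σ s τ : Finset (Fin k → ℝ)}
    (hσ : AffineIndependent ℝ ((↑) : σ → Fin k → ℝ)) (hσc : σ.card = k + 1)
    (hspace : K.space = convexHull ℝ (σ : Set (Fin k → ℝ))) (hτ : τ ∈ K.faces) (hτc : τ.card = k)
    (hs : s ∈ cells K) (hτs : τ ⊆ s) (huniq : ∀ t ∈ cells K, τ ⊆ t → t = s) :
    ∃ v ∈ σ, ∀ w ∈ τ, w ∈ convexHull ℝ ((σ.erase v : Finset (Fin k → ℝ)) : Set (Fin k → ℝ)) := by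
  obtain ⟨e, he, he'⟩ := exists_coordinates hσ hσc
  have hnn : ∀ v ∈ σ, ∀ w ∈ τ, 0 ≤ e v ⬝ᵥ lift w := fun v hv w hw =>
    (mem_convexHull_iff_coordinates he he').1 (hspace ▸ K.subset_space hτ hw) v hv
  -- If no facet of `σ` contains `τ`, every coordinate of `σ` is positive at some vertex of `τ`, so
  -- the barycenter `x` of `τ` is interior to `σ`.
  by_contra hcon
  push Not at hcon
  have hpos : ∀ v ∈ σ, ∃ w ∈ τ, 0 < e v ⬝ᵥ lift w := by
    intro v hv
    obtain ⟨w, hw, hw'⟩ := hcon v hv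
    refine ⟨w, hw, lt_of_le_of_ne (hnn v hv w hw) fun h0 => hw' ?_⟩
    rw [mem_convexHull_iff_lift]
    refine ⟨fun u => e u ⬝ᵥ lift w, fun u hu => hnn u (Finset.mem_of_mem_erase hu) w hw, ?_⟩
    conv_lhs => rw [he' (lift w), ← Finset.add_sum_erase _ _ hv, ← h0, zero_smul, zero_add]
  obtain ⟨x, c, hc, hx⟩ := exists_barycenter (K.nonempty_of_mem_faces hτ)
  have hxpos : ∀ v ∈ σ, 0 < e v ⬝ᵥ lift x := by
    intro v hv
    rw [hx, dotProduct_sum]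
    simp only [dotProduct_smul, smul_eq_mul]
    obtain ⟨w, hw, hw'⟩ := hpos v hv
    exact Finset.sum_pos' (fun u hu => mul_nonneg hc.le (hnn v hv u hu)) ⟨w, hw, by positivity⟩
  obtain ⟨v₀, hv₀, hv₀τ⟩ : ∃ v ∈ s, v ∉ τ := by
    by_contra hcon
    push Not at hcon
    have h := Finset.card_le_card hcon
    rw [hτc, hs.2] at h
    omega
  have hn0 := normal_dotProduct_ne_zero (K.indep hs.1) hs.2 hτs hτc hv₀ hv₀τ
  -- A small step from `x` away from `v₀` stays in `σ`, and the face reached contains `x` because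
  -- there are finitely many closed faces. That face contains `τ`, so by uniqueness it lies in `s`,
  -- which is on the side of `v₀` only.
  have hcont : Tendsto (fun ε : ℝ => x + (-ε) • (v₀ - x)) (𝓝[>] 0) (𝓝 x) := by
    have : Tendsto (fun ε : ℝ => x + (-ε) • (v₀ - x)) (𝓝 0) (𝓝 (x + (-0 : ℝ) • (v₀ - x))) :=
      Continuous.tendsto (by fun_prop) 0
    simp only [neg_zero, zero_smul, add_zero] at this
    exact this.mono_left nhdsWithin_le_nhds
  have h1 : ∀ᶠ ε in 𝓝[>] (0 : ℝ), x + (-ε) • (v₀ - x) ∈ K.space := by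
    rw [hspace]
    simp only [mem_convexHull_iff_coordinates he he']
    have : ∀ᶠ y in 𝓝 x, ∀ v ∈ (σ : Set (Fin k → ℝ)), 0 < e v ⬝ᵥ lift y := by
      rw [eventually_all_finite σ.finite_toSet]
      intro v hv
      have hct : Continuous fun y : Fin k → ℝ => e v ⬝ᵥ lift y := by
        unfold lift
        fun_prop
      exact (hct.tendsto x).eventually (lt_mem_nhds (hxpos v hv))
    exact (hcont.eventually this).mono fun ε hε v hv => (hε v hv).le
  have h2 : ∀ᶠ ε in 𝓝[>] (0 : ℝ), ∀ ρ ∈ K.faces, x ∉ convexHull ℝ (ρ : Set (Fin k → ℝ)) →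
      x + (-ε) • (v₀ - x) ∉ convexHull ℝ (ρ : Set (Fin k → ℝ)) := by
    rw [eventually_all_finite hK]
    intro ρ _
    by_cases hxρ : x ∈ convexHull ℝ (ρ : Set (Fin k → ℝ))
    · exact Eventually.of_forall fun _ h => absurd hxρ h
    · have hcl : IsClosed (convexHull ℝ (ρ : Set (Fin k → ℝ))) :=
        (ρ.finite_toSet.isCompact_convexHull ℝ).isClosed
      exact (hcont.eventually (hcl.isOpen_compl.mem_nhds hxρ)).mono fun ε hε _ => hε
  obtain ⟨ε, ⟨h3, h4⟩, h5⟩ := ((h1.and h2).and self_mem_nhdsWithin).exists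
  have hε : (0 : ℝ) < ε := h5
  obtain ⟨ρ, hρ, hyρ⟩ := K.mem_space_iff.1 h3
  have hxρ : x ∈ convexHull ℝ (ρ : Set (Fin k → ℝ)) := by
    by_contra hxρ
    exact h4 ρ hρ hxρ hyρ
  have hτρ := subset_of_barycenter_mem hρ hτ hc hx hxρ
  have hny : normal τ ⬝ᵥ lift (x + (-ε) • (v₀ - x)) = -ε * (normal τ ⬝ᵥ lift v₀) := by
    have h7 : normal τ ⬝ᵥ lift x = 0 := by
      rw [hx, dotProduct_sum]
      exact Finset.sum_eq_zero fun u hu => by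
        rw [dotProduct_smul, normal_dotProduct hτc hu, smul_zero]
    rw [lift_lineMap, dotProduct_add, dotProduct_smul, dotProduct_sub, h7, smul_eq_mul]
    ring
  obtain ⟨d, hd0, hd⟩ := mem_convexHull_iff_lift.1 hyρ
  have hle : ρ ⊆ s := by
    rcases (Finset.card_le_card hτρ).eq_or_lt with h | h
    · rw [← Finset.eq_of_subset_of_card_le hτρ h.ge]
      exact hτs
    · rw [huniq ρ ⟨hρ, le_antisymm (card_le_of_mem_faces hρ) (by omega)⟩ hτρ]
  have hins : insert v₀ τ = s := Finset.eq_of_subset_of_card_le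
    (Finset.insert_subset hv₀ hτs) (by rw [Finset.card_insert_of_notMem hv₀τ, hτc, hs.2])
  have h8 : 0 ≤ (normal τ ⬝ᵥ lift (x + (-ε) • (v₀ - x))) * (normal τ ⬝ᵥ lift v₀) := by
    rw [hd, dotProduct_sum, Finset.sum_mul]
    refine Finset.sum_nonneg fun u hu => ?_
    have := hle hu
    rw [← hins, Finset.mem_insert] at this
    rw [dotProduct_smul, smul_eq_mul]
    rcases this with rfl | huτ
    · rw [mul_assoc]
      exact mul_nonneg (hd0 _ hu) (mul_self_nonneg _)
    · rw [normal_dotProduct hτc huτ]; simp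
  rw [hny] at h8
  have := mul_self_pos.2 hn0
  nlinarith

end Complexes

/-! ### Consequences of freeness: facet conditions suffice, and stars are connected. -/

section FreeSplines

open scoped Classical

variable {k r : ℕ} {K : Geometry.SimplicialComplex ℝ (Fin k → ℝ)}

theorem affineIndependent_of_subset {s τ : Finset (Fin k → ℝ)} (hs : s ∈ K.faces) (h : τ ⊆ s) :
    AffineIndependent ℝ ((↑) : τ → Fin k → ℝ) :=
  (K.indep hs).comp_embedding (⟨fun v : τ => (⟨v.1, h v.2⟩ : s), fun _ _ hvw =>
    Subtype.ext (congrArg (fun u : s => u.1) hvw)⟩ : τ ↪ s)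

/-- The smoothness conditions across the common facets of adjacent cells. -/
def FacetCompatible (r : ℕ) (K : Geometry.SimplicialComplex ℝ (Fin k → ℝ))
    (f : cells K → PolyRing k) : Prop :=
  ∀ s t : cells K, (s.1 ∩ t.1).card = k → form (normal (s.1 ∩ t.1)) ^ (r + 1) ∣ f s - f t

theorem facetCompatible_of_mem_splines {f : cells K → PolyRing k} (hf : f ∈ splines r K) :
    FacetCompatible r K f := fun s t hst =>
  form_normal_pow_dvd (affineIndependent_of_subset s.2.1 Finset.inter_subset_left) hst fun _ hx =>
    vanishesAt_of_mem_splines hf s t (coneCell_mono Finset.inter_subset_left hx)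
      (coneCell_mono Finset.inter_subset_right hx)

theorem vanishesAt_of_normal_pow_dvd {τ : Finset (Fin k → ℝ)} (hτ : τ.card = k) {p : PolyRing k}
    (h : form (normal τ) ^ (r + 1) ∣ p) {x : Fin (k + 1) → ℝ} (hx : x ∈ coneCell τ) :
    VanishesAt r p x :=
  vanishesAt_of_form_pow_dvd
    (dotProduct_eq_zero_of_mem_coneCell (fun _ hv => normal_dotProduct hτ hv) hx) h

theorem not_form_dvd_form {a b : Fin (k + 1) → ℝ} (h : LinearIndependent ℝ ![a, b]) :
    ¬ form a ∣ form b := by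
  have ha : a ≠ 0 := h.ne_zero 0
  rw [form_dvd_form_iff ha, Submodule.mem_span_singleton]
  rintro ⟨c, hc⟩
  exact (LinearIndependent.pair_iff' ha).1 h c hc

/-- If the spline module is free, then splines are characterized by the smoothness conditions
across facets. -/
theorem mem_splines_of_facetCompatible (hK : K.faces.Finite)
    [Module.Free (PolyRing k) (splines r K)] {f : cells K → PolyRing k}
    (hf : FacetCompatible r K f) : f ∈ splines r K := by
  have hfin : (cells K).Finite := hK.subset fun s hs => hs.1
  have : Fintype (cells K) := hfin.fintype
  -- `Q` collects the pairs of cells whose jet condition is not yet known; it is emptied by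
  -- induction.
  have key : ∀ (Q : Finset (cells K × cells K)) (g : cells K → PolyRing k),
      FacetCompatible r K g → (∀ s t : cells K, (s, t) ∉ Q → ∀ x ∈ coneCell s.1,
        x ∈ coneCell t.1 → VanishesAt r (g s - g t) x) → g ∈ splines r K := by
    intro Q
    induction Q using Finset.induction_on with
    | empty => exact fun g _ h => (mem_splines_iff hK).2 fun s t => h s t (Finset.notMem_empty _)
    | insert p Q _ ih =>
      intro g hg h
      obtain ⟨s, t⟩ := p
      by_cases hst : s = t
      · refine ih g hg fun s' t' hQ x hx hx' => ?_
        by_cases he : (s', t') = (s, t)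
        · simp only [Prod.mk.injEq] at he
          rw [he.1, he.2, hst, sub_self]
          exact vanishesAt_zero r x
        · exact h s' t' (by simp [hQ] at he ⊢; tauto) x hx hx'
      by_cases hc : (s.1 ∩ t.1).card = k
      · refine ih g hg fun s' t' hQ x hx hx' => ?_
        by_cases he : (s', t') = (s, t)
        · simp only [Prod.mk.injEq] at he
          rw [he.1] at hx ⊢
          rw [he.2] at hx' ⊢
          exact vanishesAt_of_normal_pow_dvd hc (hg s t hc)
            (coneCell_inter_subset s.2.1 t.2.1 ⟨hx, hx'⟩)
        · exact h s' t' (by simp [hQ] at he ⊢; tauto) x hx hx'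
      have hlt : (s.1 ∩ t.1).card < k := by
        refine lt_of_le_of_ne ?_ hc
        have h1 : (s.1 ∩ t.1).card ≤ s.1.card := Finset.card_le_card Finset.inter_subset_left
        rw [s.2.2] at h1
        by_contra hlt
        refine hst (Subtype.ext ?_)
        have h2 := Finset.eq_of_subset_of_card_le (Finset.inter_subset_left (s₁ := s.1) (s₂ := t.1))
          (by rw [s.2.2]; omega)
        have h3 := Finset.eq_of_subset_of_card_le
          (Finset.inter_subset_right (s₁ := s.1) (s₂ := t.1)) (by rw [t.2.2]; omega)
        exact h2.symm.trans h3
      -- For cells meeting in codimension at least two, multiplying `g` by a power of either form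
      -- enforces the missing condition. Both products are splines by induction, and coprimality in
      -- the free spline module lets the power be cancelled.
      obtain ⟨a, b, hab, hv⟩ := exists_two_normals hlt
      have ha : a ≠ 0 := hab.ne_zero 0
      have step : ∀ c : Fin (k + 1) → ℝ, (∀ v ∈ s.1 ∩ t.1, c ⬝ᵥ lift v = 0) →
          form c ^ (r + 1) • g ∈ splines r K := by
        intro c hcv
        have hsub : ∀ s t : cells K, (form c ^ (r + 1) • g) s - (form c ^ (r + 1) • g) t
            = form c ^ (r + 1) * (g s - g t) := fun s t => by simp [mul_sub]
        refine ih _ (fun s' t' h' => ?_) fun s' t' hQ x hx hx' => ?_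
        · rw [hsub]
          exact (hg s' t' h').mul_left _
        · rw [hsub]
          by_cases he : (s', t') = (s, t)
          · simp only [Prod.mk.injEq] at he
            rw [he.1] at hx ⊢
            rw [he.2] at hx' ⊢
            exact vanishesAt_of_form_pow_dvd (dotProduct_eq_zero_of_mem_coneCell hcv
              (coneCell_inter_subset s.2.1 t.2.1 ⟨hx, hx'⟩)) (dvd_mul_right _ _)
          · exact (h s' t' (by simp [hQ] at he ⊢; tauto) x hx hx').mul_left _
      have hga := step a fun v h => (hv v h).1
      have hgb := step b fun v h => (hv v h).2
      have hpow : form a ^ (r + 1) ≠ 0 := pow_ne_zero _ (form_eq_zero_iff.not.2 ha)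
      have hxy : form a ^ (r + 1) • (⟨_, hgb⟩ : splines r K)
          = form b ^ (r + 1) • (⟨_, hga⟩ : splines r K) :=
        Subtype.ext (smul_comm _ _ _)
      obtain ⟨w, hw, -⟩ := free_coprime (S := splines r K) hpow (fun z hz => (prime_form ha).pow_dvd_of_dvd_mul_left _
        (fun hd => not_form_dvd_form hab ((prime_form ha).dvd_of_dvd_pow hd)) hz) hxy
      have hw' : form a ^ (r + 1) • g = form a ^ (r + 1) • (w : cells K → PolyRing k) :=
        congrArg Subtype.val hw
      rw [smul_right_injective _ hpow hw']
      exact w.2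
  exact key Finset.univ f hf fun s t h => absurd (Finset.mem_univ _) h

/-- Adjacency of cells through a facet containing `γ`. -/
def AdjOver (γ : Finset (Fin k → ℝ)) (s t : cells K) : Prop :=
  (s.1 ∩ t.1).card = k ∧ γ ⊆ s.1 ∩ t.1

/-- If the spline module is free, then any two cells containing `γ` are connected by a chain of
cells which are adjacent through facets containing `γ`. -/
theorem reflTransGen_adjOver_of_free (r : ℕ) (hK : K.faces.Finite)
    [Module.Free (PolyRing k) (splines r K)] {γ : Finset (Fin k → ℝ)} {s t : cells K}
    (hs : γ ⊆ s.1) (ht : γ ⊆ t.1) : Relation.ReflTransGen (AdjOver γ) s t := by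
  have hfin : (cells K).Finite := hK.subset fun s hs => hs.1
  have : Fintype (cells K) := hfin.fintype
  by_contra hcon
  -- `P` is the class of cells reached from `s`. The family `g`, equal on `P` to a product of powers
  -- of the facet forms separating `P` from the rest and zero elsewhere, is a spline. Hence this
  -- product vanishes at points common to `s` and `t`; but no separating facet contains `γ`, so it
  -- is nonzero at a point in the relative interior of the cone over `γ`.
  let P : cells K → Prop := fun q => γ ⊆ q.1 ∧ Relation.ReflTransGen (AdjOver γ) s q
  let fac : cells K → cells K → PolyRing k := fun q q' =>
    if P q ∧ ¬ P q' ∧ (q.1 ∩ q'.1).card = k then form (normal (q.1 ∩ q'.1)) ^ (r + 1) else 1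
  let a : PolyRing k := ∏ q, ∏ q', fac q q'
  let g : cells K → PolyRing k := fun q => if P q then a else 0
  have hdvd : ∀ q q' : cells K, P q → ¬ P q' → (q.1 ∩ q'.1).card = k →
      form (normal (q.1 ∩ q'.1)) ^ (r + 1) ∣ a := by
    intro q q' h1 h2 h3
    have h4 : fac q q' = form (normal (q.1 ∩ q'.1)) ^ (r + 1) := if_pos ⟨h1, h2, h3⟩
    rw [← h4]
    exact (Finset.dvd_prod_of_mem (fac q) (Finset.mem_univ q')).trans
      (Finset.dvd_prod_of_mem (fun q => ∏ q', fac q q') (Finset.mem_univ q))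
  have hg : FacetCompatible r K g := by
    intro q q' hqq
    by_cases h1 : P q <;> by_cases h2 : P q' <;> simp only [g, h1, h2, if_true, if_false]
    · simp
    · simpa using hdvd q q' h1 h2 hqq
    · rw [zero_sub, dvd_neg, Finset.inter_comm]
      rw [Finset.inter_comm] at hqq
      exact hdvd q' q h2 h1 hqq
    · simp
  let c : ℝ := 1 / (γ.card + 1)
  have hc : 0 < c := by positivity
  let x := ∑ v ∈ γ, c • lift v
  have hx : x ∈ coneCell γ := mem_coneCell_iff.2 ⟨fun _ => c, fun _ _ => hc.le, by
    rw [Finset.sum_const, nsmul_eq_mul, mul_one_div, div_le_one (by positivity)]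
    linarith, rfl⟩
  have h0 := (vanishesAt_of_mem_splines (mem_splines_of_facetCompatible hK hg) s t
    (coneCell_mono hs hx) (coneCell_mono ht hx)).eval_eq_zero
  have hPs : P s := ⟨hs, Relation.ReflTransGen.refl⟩
  have hPt : ¬ P t := fun h => hcon h.2
  simp only [g, hPs, hPt, if_true, if_false, sub_zero, a, map_prod, Finset.prod_eq_zero_iff,
    Finset.mem_univ, true_and] at h0
  obtain ⟨q, q', h1⟩ := h0
  by_cases h2 : P q ∧ ¬ P q' ∧ (q.1 ∩ q'.1).card = k
  · simp only [fac, if_pos h2, map_pow, eval_form] at h1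
    have h3 := pow_eq_zero_iff (Nat.succ_ne_zero r) |>.1 h1
    obtain ⟨⟨hγq, hq⟩, hq', hc'⟩ := h2
    have h4 : ¬ γ ⊆ q'.1 := fun h =>
      hq' ⟨h, hq.tail ⟨hc', Finset.subset_inter hγq h⟩⟩
    obtain ⟨v, hv, hvq'⟩ := Finset.not_subset.1 h4
    have hvn : v ∉ q.1 ∩ q'.1 := fun h => hvq' (Finset.mem_inter.1 h).2
    have hins : insert v (q.1 ∩ q'.1) = q.1 := Finset.eq_of_subset_of_card_le
      (Finset.insert_subset (hγq hv) Finset.inter_subset_left)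
      (by rw [Finset.card_insert_of_notMem hvn, q.2.2, hc'])
    rw [dotProduct_sum, Finset.sum_eq_single_of_mem v hv fun w hw hwv => ?_, dotProduct_smul,
      smul_eq_mul, mul_eq_zero] at h3
    · exact h3.elim hc.ne' (normal_dotProduct_ne_zero (K.indep q.2.1) q.2.2
        Finset.inter_subset_left hc' (hγq hv) hvn)
    · have := hγq hw
      rw [← hins, Finset.mem_insert] at this
      rw [dotProduct_smul, normal_dotProduct hc' (this.resolve_left hwv), smul_zero]
  · simp only [fac, if_neg h2, map_one, one_ne_zero] at h1

end FreeSplines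

/-! ### A degree count. -/

section Graphs

/-- A connected graph of maximal degree two has at most two vertices of degree at most one. -/
theorem false_of_three_leaves {V : Type*} [Finite V] (G : SimpleGraph V)
    (h : ∀ v a b c, G.Adj v a → G.Adj v b → G.Adj v c → a = b ∨ a = c ∨ b = c)
    {x y z : V} (hxy : G.Reachable x y) (hxz : G.Reachable x z) (h1 : x ≠ y) (h2 : x ≠ z)
    (h3 : y ≠ z) (hx : ∀ a b, G.Adj x a → G.Adj x b → a = b)
    (hy : ∀ a b, G.Adj y a → G.Adj y b → a = b) (hz : ∀ a b, G.Adj z a → G.Adj z b → a = b) :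
    False := by
  classical
  have := Fintype.ofFinite V
  let C := G.connectedComponentMk x
  let H := C.toSimpleGraph
  have hH : H.Connected := C.connected_toSimpleGraph
  have hadj : ∀ u v : C, H.Adj u v → G.Adj u.1 v.1 := fun u v huv => huv
  have hx' : x ∈ C := SimpleGraph.ConnectedComponent.connectedComponentMk_mem
  have hy' : y ∈ C := SimpleGraph.ConnectedComponent.sound hxy.symm
  have hz' : z ∈ C := SimpleGraph.ConnectedComponent.sound hxz.symm
  let T : Finset C := {⟨x, hx'⟩, ⟨y, hy'⟩, ⟨z, hz'⟩}
  have hT : T.card = 3 := by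
    rw [Finset.card_eq_three]
    exact ⟨_, _, _, by simpa [Subtype.ext_iff] using h1, by simpa [Subtype.ext_iff] using h2,
      by simpa [Subtype.ext_iff] using h3, rfl⟩
  -- Summation bounds the degree sum by twice the number of vertices minus 3, whereas a connected
  -- graph has degree sum at least twice the number of vertices minus 2.
  have hle : ∀ v : C, H.degree v + (if v ∈ T then 1 else 0) ≤ 2 := by
    intro v
    have hone : (∀ a b, G.Adj v.1 a → G.Adj v.1 b → a = b) → H.degree v ≤ 1 := by
      intro hv
      rw [← SimpleGraph.card_neighborFinset_eq_degree, Finset.card_le_one]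
      intro a ha b hb
      rw [SimpleGraph.mem_neighborFinset] at ha hb
      exact Subtype.ext (hv _ _ (hadj _ _ ha) (hadj _ _ hb))
    split_ifs with hv
    · have : H.degree v ≤ 1 := by
        simp only [T, Finset.mem_insert, Finset.mem_singleton] at hv
        rcases hv with rfl | rfl | rfl
        exacts [hone hx, hone hy, hone hz]
      omega
    · rw [← SimpleGraph.card_neighborFinset_eq_degree, add_zero]
      by_contra hlt
      push Not at hlt
      obtain ⟨a, b, c, ha, hb, hc, hab, hac, hbc⟩ := Finset.two_lt_card_iff.1 hlt
      rw [SimpleGraph.mem_neighborFinset] at ha hb hc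
      rcases h _ _ _ _ (hadj _ _ ha) (hadj _ _ hb) (hadj _ _ hc) with h' | h' | h'
      exacts [hab (Subtype.ext h'), hac (Subtype.ext h'), hbc (Subtype.ext h')]
  have hsum := Finset.sum_le_sum fun v (_ : v ∈ (Finset.univ : Finset C)) => hle v
  rw [Finset.sum_add_distrib, SimpleGraph.sum_degrees_eq_twice_card_edges] at hsum
  simp only [Finset.sum_ite_mem, Finset.univ_inter, Finset.sum_const, smul_eq_mul, mul_one, hT,
    Finset.card_univ] at hsum
  have hcard := hH.card_vert_le_card_edgeSet_add_one
  rw [Nat.card_eq_fintype_card, Nat.card_eq_fintype_card, ← SimpleGraph.edgeFinset_card] at hcard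
  omega

end Graphs

/-! ### Stars of faces of codimension two. -/

section Stars

open scoped Classical

variable {k : ℕ} {K : Geometry.SimplicialComplex ℝ (Fin k → ℝ)}

/-- A `k`-simplex has only two facets containing a given `(k-2)`-face. -/
theorem facets_over_codim_two {γ q ρ₁ ρ₂ ρ₃ : Finset (Fin k → ℝ)} (hγ : γ.card + 1 = k)
    (hq : q.card = k + 1) (h1 : ρ₁.card = k) (h2 : ρ₂.card = k) (h3 : ρ₃.card = k)
    (hq1 : ρ₁ ⊆ q) (hq2 : ρ₂ ⊆ q) (hq3 : ρ₃ ⊆ q) (hγ1 : γ ⊆ ρ₁) (hγ2 : γ ⊆ ρ₂) (hγ3 : γ ⊆ ρ₃) :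
    ρ₁ = ρ₂ ∨ ρ₁ = ρ₃ ∨ ρ₂ = ρ₃ := by
  -- A facet over `γ` omits one vertex of `q \ γ`, and there are only two of these.
  have hex : ∀ ρ : Finset (Fin k → ℝ), ρ.card = k → ρ ⊆ q → γ ⊆ ρ →
      ∃ b ∈ q \ γ, ρ = q.erase b := by
    intro ρ hρ hρq hγρ
    obtain ⟨b, hb⟩ : ∃ b, q \ ρ = {b} := by
      rw [← Finset.card_eq_one, Finset.card_sdiff_of_subset hρq]; omega
    have hb' : b ∈ q \ ρ := by rw [hb]; exact Finset.mem_singleton_self b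
    rw [Finset.mem_sdiff] at hb'
    refine ⟨b, Finset.mem_sdiff.2 ⟨hb'.1, fun h => hb'.2 (hγρ h)⟩, ?_⟩
    rw [Finset.erase_eq, ← hb, Finset.sdiff_sdiff_eq_self hρq]
  obtain ⟨b₁, hb1, e1⟩ := hex ρ₁ h1 hq1 hγ1
  obtain ⟨b₂, hb2, e2⟩ := hex ρ₂ h2 hq2 hγ2
  obtain ⟨b₃, hb3, e3⟩ := hex ρ₃ h3 hq3 hγ3
  by_contra hcon
  push Not at hcon
  have hlt : 2 < (q \ γ).card := Finset.two_lt_card_iff.2 ⟨b₁, b₂, b₃, hb1, hb2, hb3,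
    fun h => hcon.1 (by rw [e1, e2, h]), fun h => hcon.2.1 (by rw [e1, e3, h]),
    fun h => hcon.2.2 (by rw [e2, e3, h])⟩
  rw [Finset.card_sdiff_of_subset (hγ1.trans hq1)] at hlt
  omega

theorem ne_of_inter_card {s t : cells K} (h : (s.1 ∩ t.1).card = k) : s ≠ t := by
  rintro rfl
  rw [Finset.inter_self, s.2.2] at h
  omega

/-- A facet lies in at most two cells, so it determines the neighbour of `q` across it. -/
theorem eq_of_inter_eq {q a b : cells K} (h : (q.1 ∩ a.1).card = k) (hab : q.1 ∩ a.1 = q.1 ∩ b.1) :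
    a = b :=
  Subtype.ext (eq_of_facet_subset q.2 a.2 b.2 h Finset.inter_subset_left Finset.inter_subset_right
    (hab ▸ Finset.inter_subset_right)
    (fun h' => ne_of_inter_card h (Subtype.ext h'))
    (fun h' => ne_of_inter_card (hab ▸ h) (Subtype.ext h')))

/-- The graph of cells other than `σ` which are adjacent through a facet containing `γ` and
different from `τ`. -/
def starGraph (γ : Finset (Fin k → ℝ)) (σ : cells K) (τ : Finset (Fin k → ℝ)) :
    SimpleGraph (cells K) where
  Adj q q' := q ≠ σ ∧ q' ≠ σ ∧ AdjOver γ q q' ∧ q.1 ∩ q'.1 ≠ τ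
  symm := ⟨fun q q' h => ⟨h.2.1, h.1, by
    simpa [AdjOver, Finset.inter_comm] using h.2.2.1, by
    simpa [Finset.inter_comm] using h.2.2.2⟩⟩
  loopless := ⟨fun q h => ne_of_inter_card h.2.2.1.1 rfl⟩

/-- Removing a cell `σ` and a facet `τ` from the star of a face of codimension two separates the
two neighbours of `σ`. -/
theorem not_reachable_starGraph (hK : K.faces.Finite) {γ τ : Finset (Fin k → ℝ)}
    (hconn : ∀ s t : cells K, γ ⊆ s.1 → γ ⊆ t.1 → Relation.ReflTransGen (AdjOver γ) s t)
    (hγ : γ.card + 1 = k) {σ t₁ t₂ : cells K} (h1 : AdjOver γ σ t₁) (h2 : AdjOver γ σ t₂)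
    (h12 : σ.1 ∩ t₁.1 ≠ σ.1 ∩ t₂.1) (hτ : τ.card = k) (hγτ : γ ⊆ τ) {c : cells K} (hc : τ ⊆ c.1)
    (hτ1 : τ ≠ σ.1 ∩ t₁.1) (hτ2 : τ ≠ σ.1 ∩ t₂.1) :
    ¬ (starGraph γ σ τ).Reachable t₁ t₂ := by
  intro hr
  have hfin : Finite (cells K) := (hK.subset fun s hs => hs.1).to_subtype
  set G := starGraph γ σ τ with hG
  -- A cell has only two facets over `γ`; blocking one of them leaves at most one neighbour.
  have htwo : ∀ v a b : cells K, ∀ ρ : Finset (Fin k → ℝ), ρ.card = k → γ ⊆ ρ → ρ ⊆ v.1 →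
      G.Adj v a → G.Adj v b → v.1 ∩ a.1 ≠ ρ → v.1 ∩ b.1 ≠ ρ → a = b := by
    intro v a b ρ hρ hγρ hρv ha hb hna hnb
    rcases facets_over_codim_two hγ v.2.2 ha.2.2.1.1 hb.2.2.1.1 hρ Finset.inter_subset_left
      Finset.inter_subset_left hρv ha.2.2.1.2 hb.2.2.1.2 hγρ with h | h | h
    exacts [eq_of_inter_eq ha.2.2.1.1 h, absurd h hna, absurd h hnb]
  have hthree : ∀ v a b c : cells K, G.Adj v a → G.Adj v b → G.Adj v c →
      a = b ∨ a = c ∨ b = c := by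
    intro v a b c ha hb hc
    by_cases h1 : v.1 ∩ a.1 = v.1 ∩ c.1
    · exact Or.inr (Or.inl (eq_of_inter_eq ha.2.2.1.1 h1))
    by_cases h2 : v.1 ∩ b.1 = v.1 ∩ c.1
    · exact Or.inr (Or.inr (eq_of_inter_eq hb.2.2.1.1 h2))
    exact Or.inl (htwo v a b _ hc.2.2.1.1 hc.2.2.1.2 Finset.inter_subset_left ha hb h1 h2)
  have hnσ : ∀ t a : cells K, AdjOver γ σ t → G.Adj t a → t.1 ∩ a.1 ≠ σ.1 ∩ t.1 := by
    intro t a ht ha h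
    rw [Finset.inter_comm σ.1] at h
    exact ha.2.1 (eq_of_inter_eq ha.2.2.1.1 h)
  have hleaf : ∀ t : cells K, AdjOver γ σ t → ∀ a b, G.Adj t a → G.Adj t b → a = b :=
    fun t ht a b ha hb => htwo t a b _ ht.1 ht.2 Finset.inter_subset_right ha hb
      (hnσ t a ht ha) (hnσ t b ht hb)
  have hleafτ : ∀ c : cells K, τ ⊆ c.1 → ∀ a b, G.Adj c a → G.Adj c b → a = b :=
    fun c hc a b ha hb => htwo c a b τ hτ hγτ hc ha hb ha.2.2.2 hb.2.2.2
  -- If `t` contains both `τ` and its facet towards `σ`, both of its facets over `γ` are blocked.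
  have hiso : ∀ t : cells K, AdjOver γ σ t → τ ≠ σ.1 ∩ t.1 → τ ⊆ t.1 → ∀ a, ¬ G.Adj t a := by
    intro t ht hne hτt a ha
    rcases facets_over_codim_two hγ t.2.2 ha.2.2.1.1 ht.1 hτ Finset.inter_subset_left
      Finset.inter_subset_right hτt ha.2.2.1.2 ht.2 hγτ with h | h | h
    exacts [hnσ t a ht ha h, ha.2.2.2 h, hne h.symm]
  have ht12 : t₁ ≠ t₂ := fun h => h12 (by rw [h])
  have hisoR : ∀ t t' : cells K, (∀ a, ¬ G.Adj t a) → G.Reachable t t' → t = t' := by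
    intro t t' ht htt
    obtain ⟨p⟩ := htt
    cases p with
    | nil => rfl
    | cons h _ => exact absurd h (ht _)
  -- A reachable cell over `τ` would be a third leaf besides `t₁` and `t₂`, whose facets towards `σ`
  -- are blocked.
  have hno : ∀ c : cells K, G.Reachable t₁ c → ¬ τ ⊆ c.1 := by
    intro c hrc hτc
    have hc1 : t₁ ≠ c := by
      rintro rfl
      exact ht12 (hisoR _ _ (hiso _ h1 hτ1 hτc) hr)
    have hc2 : t₂ ≠ c := by
      rintro rfl
      exact ht12 (hisoR _ _ (hiso _ h2 hτ2 hτc) hr.symm).symm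
    exact false_of_three_leaves G hthree hr hrc ht12 hc1 hc2 (hleaf t₁ h1) (hleaf t₂ h2)
      (hleafτ c hτc)
  have hτσ : ¬ τ ⊆ σ.1 := by
    intro h
    rcases facets_over_codim_two hγ σ.2.2 h1.1 h2.1 hτ Finset.inter_subset_left
      Finset.inter_subset_left h h1.2 h2.2 hγτ with h' | h' | h'
    exacts [h12 h', hτ1 h'.symm, hτ2 h'.symm]
  -- Hence the component of `t₁` is never cut at `τ`. Together with `σ` it is closed under adjacency
  -- over `γ`, so by connectedness it contains the cell `c` over `τ`, which is impossible.
  have hclosed : ∀ q : cells K, Relation.ReflTransGen (AdjOver γ) σ q →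
      q = σ ∨ G.Reachable t₁ q := by
    intro q hq
    induction hq with
    | refl => exact Or.inl rfl
    | @tail q q' _ hqq' ih =>
      by_cases hq : q = σ
      · subst hq
        right
        rcases facets_over_codim_two hγ q.2.2 hqq'.1 h1.1 h2.1 Finset.inter_subset_left
          Finset.inter_subset_left Finset.inter_subset_left hqq'.2 h1.2 h2.2 with h' | h' | h'
        · rw [eq_of_inter_eq hqq'.1 h']
        · rw [eq_of_inter_eq hqq'.1 h']
          exact hr
        · exact absurd h' h12
      · by_cases hq' : q' = σ
        · exact Or.inl hq'
        · have hrq := ih.resolve_left hq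
          refine Or.inr (hrq.trans (SimpleGraph.Adj.reachable ?_))
          exact ⟨hq, hq', hqq', fun h => hno q hrq (h ▸ Finset.inter_subset_left)⟩
  rcases hclosed c (hconn σ c (h1.2.trans Finset.inter_subset_left) (hγτ.trans hc)) with h | h
  · exact hτσ (h ▸ hc)
  · exact hno c h hc

theorem subset_of_reachable_starGraph {γ τ : Finset (Fin k → ℝ)} {σ t q : cells K} (ht : γ ⊆ t.1)
    (h : (starGraph γ σ τ).Reachable t q) : γ ⊆ q.1 := by
  rw [SimpleGraph.reachable_iff_reflTransGen] at h
  induction h with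
  | refl => exact ht
  | tail _ h _ => exact h.2.2.1.2.trans Finset.inter_subset_right

/-- A finite complex of intervals has an end point. -/
theorem exists_vertex_unique_cell {K : Geometry.SimplicialComplex ℝ (Fin 1 → ℝ)} (hK : IsMesh K)
    (hne : (cells K).Nonempty) :
    ∃ τ ∈ K.faces, τ.card = 1 ∧ ∃! s, s ∈ cells K ∧ τ ⊆ s := by
  obtain ⟨s, hs⟩ := hne
  have hfin : K.vertices.Finite := by
    rw [Geometry.SimplicialComplex.vertices_eq]
    exact hK.finite.biUnion fun s _ => s.finite_toSet
  obtain ⟨w, hw⟩ := K.nonempty_of_mem_faces hs.1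
  have hmem : ∀ {s : Finset (Fin 1 → ℝ)} {v}, s ∈ K.faces → v ∈ s → v ∈ K.vertices := fun hs hv =>
    K.down_closed hs (Finset.singleton_subset_iff.2 hv) (Finset.singleton_nonempty _)
  -- Two cells at the rightmost vertex would both lie to its left, although adjacent cells lie on
  -- opposite sides.
  obtain ⟨v, hv, hmax⟩ := hfin.exists_maximalFor (fun v => v 0) _ ⟨w, hmem hs.1 hw⟩
  obtain ⟨s, hs, hvs⟩ := hK.pure _ hv
  refine ⟨{v}, hv, Finset.card_singleton v, s, ⟨hs, hvs⟩, ?_⟩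
  rintro t ⟨ht, hvt⟩
  by_contra hts
  have hi := inter_eq_of_ne ht.2 hs.2 hts hvt hvs (Finset.card_singleton v)
  have hex : ∀ u ∈ cells K, {v} ⊆ u → ∃ a ∈ u, a ∉ ({v} : Finset (Fin 1 → ℝ)) ∧ a 0 ≤ v 0 := by
    intro u hu hvu
    by_contra hcon
    push Not at hcon
    have hsub : u ⊆ {v} := fun a ha => by
      by_contra hav
      refine (hcon a ha hav).not_ge ?_
      by_contra hlt
      exact hlt (hmax (hmem hu.1 ha) (le_of_not_ge hlt))
    have := Finset.card_le_card hsub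
    rw [hu.2, Finset.card_singleton] at this
    omega
  obtain ⟨a, ha, hav, hale⟩ := hex t ht hvt
  obtain ⟨b, hb, hbv, hble⟩ := hex s hs hvs
  have hneg := normal_mul_neg ht hs (by rw [hi, Finset.card_singleton]) ha
    (fun h => hav (hi ▸ Finset.mem_inter.2 ⟨ha, h⟩)) hb
    (fun h => hbv (hi ▸ Finset.mem_inter.2 ⟨h, hb⟩))
  rw [hi] at hneg
  have h0 := normal_dotProduct (k := 1) (Finset.card_singleton v) (Finset.mem_singleton_self v)
  have hdot : ∀ x : Fin 1 → ℝ, normal ({v} : Finset (Fin 1 → ℝ)) ⬝ᵥ lift x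
      = normal ({v} : Finset (Fin 1 → ℝ)) 0 + normal ({v} : Finset (Fin 1 → ℝ)) 1 * x 0 := by
    intro x
    simp [dotProduct, Fin.sum_univ_two, lift]
  rw [hdot] at h0
  rw [hdot, hdot] at hneg
  set m := normal ({v} : Finset (Fin 1 → ℝ))
  have e : (m 0 + m 1 * a 0) * (m 0 + m 1 * b 0) = (m 1) ^ 2 * ((v 0 - a 0) * (v 0 - b 0)) := by
    have : m 0 = - (m 1 * v 0) := by linarith
    rw [this]; ring
  rw [e] at hneg
  have := mul_nonneg (sq_nonneg (m 1)) (mul_nonneg (sub_nonneg.2 hale) (sub_nonneg.2 hble))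
  linarith

end Stars

/-! ### Cells and boundary of a simple subdivision. -/

section Subdivisions

open scoped Classical

variable {k r : ℕ} {Δ Δ' Δ'' : Geometry.SimplicialComplex ℝ (Fin k → ℝ)}
  {σ : Finset (Fin k → ℝ)}

theorem mem_cells_subdivision_iff (h : IsSimpleSubdivision Δ σ Δ'' Δ')
    {s : Finset (Fin k → ℝ)} :
    s ∈ cells Δ' ↔ s ∈ cells Δ'' ∨ s ∈ cells Δ ∧ s ≠ σ := by
  simp only [cells, Set.mem_ofPred_eq, h.faces_eq, Set.mem_union]
  constructor
  · rintro ⟨h1 | ⟨-, t, ht, hne, hst⟩, hs⟩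
    · exact Or.inl ⟨h1, hs⟩
    · have hst' := Finset.eq_of_subset_of_card_le hst (by rw [hs, ht.2])
      rw [hst']
      exact Or.inr ⟨ht, hne⟩
  · rintro (⟨h1, hs⟩ | ⟨hs, hne⟩)
    · exact ⟨Or.inl h1, hs⟩
    · exact ⟨Or.inr ⟨Δ.nonempty_of_mem_faces hs.1, s, hs, hne, subset_rfl⟩, hs.2⟩

theorem mem_vertices_of_mem {K : Geometry.SimplicialComplex ℝ (Fin k → ℝ)}
    {s : Finset (Fin k → ℝ)} (hs : s ∈ K.faces) {v : Fin k → ℝ} (hv : v ∈ s) : v ∈ K.vertices :=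
  K.down_closed hs (Finset.singleton_subset_iff.2 hv) (Finset.singleton_nonempty _)

/-- A common vertex of a face of the subdivision of `σ` and of a face of `Δ` is a vertex of `σ`. -/
theorem inter_subset_of_subdivision (h : IsSimpleSubdivision Δ σ Δ'' Δ')
    {s t : Finset (Fin k → ℝ)} (hs : s ∈ Δ''.faces) (ht : t ∈ Δ.faces) : s ∩ t ⊆ σ := by
  intro v hv
  rw [Finset.mem_inter] at hv
  refine (Δ.vertex_mem_convexHull_iff (mem_vertices_of_mem ht hv.2) h.cell_mem.1).1 ?_
  rw [← h.space_eq]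
  exact Δ''.subset_space hs hv.1

theorem notMem_cells_of_subdivision (h : IsSimpleSubdivision Δ σ Δ'' Δ')
    {t : Finset (Fin k → ℝ)} (ht : t ∈ cells Δ) (hne : t ≠ σ) : t ∉ cells Δ'' := by
  intro ht'
  have h1 := inter_subset_of_subdivision h ht'.1 ht.1
  rw [Finset.inter_self] at h1
  exact hne (Finset.eq_of_subset_of_card_le h1 (by rw [ht.2, h.cell_mem.2]))

/-- Interior facets of `σ` are boundary faces of the subdivision of `σ`. -/
theorem facet_mem_boundary (h : IsSimpleSubdivision Δ σ Δ'' Δ') {t : Finset (Fin k → ℝ)}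
    (ht : t ∈ cells Δ) (hσt : (σ ∩ t).card = k) : σ ∩ t ∈ boundary Δ'' := by
  have hne : σ ≠ t := by
    rintro rfl
    rw [Finset.inter_self, ht.2] at hσt
    omega
  have hnon : (σ ∩ t).Nonempty := by
    rcases Nat.eq_zero_or_pos k with hk | hk
    · subst hk
      obtain ⟨v, hv⟩ := Δ.nonempty_of_mem_faces h.cell_mem.1
      obtain ⟨w, hw⟩ := Δ.nonempty_of_mem_faces ht.1
      exact ⟨v, Finset.mem_inter.2 ⟨hv, Subsingleton.elim w v ▸ hw⟩⟩
    · rw [← Finset.card_pos, hσt]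
      exact hk
  have hface := Δ.down_closed ht.1 (Finset.inter_subset_right (s₁ := σ)) hnon
  refine (h.boundary_eq _ hface ?_).1 ?_
  · rintro ⟨-, τ, -, hτ, hsub, s, -, hs⟩
    have := Finset.eq_of_subset_of_card_le hsub (by rw [hτ, hσt])
    subst this
    exact hne ((hs σ ⟨h.cell_mem, Finset.inter_subset_left⟩).trans
      (hs t ⟨ht, Finset.inter_subset_right⟩).symm)
  · refine Finset.ssubset_iff_subset_ne.2 ⟨Finset.inter_subset_left, fun h' => ?_⟩
    rw [h', h.cell_mem.2] at hσt
    omega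

/-- The facets that `σ` shares with other cells are not subdivided in `Δ''`. -/
theorem exists_cell_over_facet (h : IsSimpleSubdivision Δ σ Δ'' Δ') {t : Finset (Fin k → ℝ)}
    (ht : t ∈ cells Δ) (hσt : (σ ∩ t).card = k) : ∃ s ∈ cells Δ'', σ ∩ t ⊆ s := by
  obtain ⟨-, τ, -, -, hsub, s, ⟨hs, hτs⟩, -⟩ := facet_mem_boundary h ht hσt
  exact ⟨s, hs, hsub.trans hτs⟩

theorem finite_faces_subdivision (h : IsSimpleSubdivision Δ σ Δ'' Δ') (hΔ : Δ.faces.Finite) :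
    Δ'.faces.Finite := by
  rw [h.faces_eq]
  refine h.finite.union (hΔ.subset ?_)
  rintro γ ⟨hγ, t, ht, -, hsub⟩
  exact Δ.down_closed ht.1 hsub hγ

/-- A face of codimension two of `σ`, both facets of `σ` over which are interior, which is not in
`∂Δ`, is not in `∂Δ'`. -/
theorem notMem_boundary_subdivision (h : IsSimpleSubdivision Δ σ Δ'' Δ')
    {γ t₁ t₂ : Finset (Fin k → ℝ)} (hγ : γ.card + 1 = k)
    (h1 : t₁ ∈ cells Δ) (h2 : t₂ ∈ cells Δ) (hc1 : (σ ∩ t₁).card = k) (hc2 : (σ ∩ t₂).card = k)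
    (hγ1 : γ ⊆ σ ∩ t₁) (hγ2 : γ ⊆ σ ∩ t₂) (hne : σ ∩ t₁ ≠ σ ∩ t₂)
    (hint : ∀ τ ∈ Δ.faces, τ.card = k → γ ⊆ τ → ¬ ∃! s, s ∈ cells Δ ∧ τ ⊆ s) :
    γ ∉ boundary Δ' := by
  rintro ⟨-, τ, hτ, hτc, hγτ, s, ⟨hs, hτs⟩, huniq⟩
  have hneσ : ∀ t : Finset (Fin k → ℝ), (σ ∩ t).card = k → t ≠ σ := by
    rintro t ht rfl
    rw [Finset.inter_self, h.cell_mem.2] at ht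
    omega
  -- Over `τ` there would be a second cell of `Δ`. It survives in `Δ'`, or it is `σ` and is replaced
  -- by a cell of `Δ''`; either way `τ` lies in two cells of `Δ'`.
  have hout : ∀ t ∈ cells Δ, t ≠ σ → ¬ τ ⊆ t := by
    intro t ht htσ hτt
    have hτΔ : τ ∈ Δ.faces := Δ.down_closed ht.1 hτt (Δ'.nonempty_of_mem_faces hτ)
    obtain ⟨t', ht', hτt', htt⟩ : ∃ t' ∈ cells Δ, τ ⊆ t' ∧ t' ≠ t := by
      by_contra hcon
      push Not at hcon
      exact hint τ hτΔ hτc hγτ ⟨t, ⟨ht, hτt⟩, fun t' ht' => hcon t' ht'.1 ht'.2⟩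
    have e1 := huniq t ⟨(mem_cells_subdivision_iff h).2 (Or.inr ⟨ht, htσ⟩), hτt⟩
    by_cases htσ' : t' = σ
    · subst htσ'
      have hi := inter_eq_of_ne ht'.2 ht.2 htt hτt' hτt hτc
      obtain ⟨q, hq, hsub⟩ := exists_cell_over_facet h ht (hi ▸ hτc)
      have e2 := huniq q ⟨(mem_cells_subdivision_iff h).2 (Or.inl hq), hi ▸ hsub⟩
      exact notMem_cells_of_subdivision h ht htσ (by rw [e1, ← e2]; exact hq)
    · exact htt ((huniq t' ⟨(mem_cells_subdivision_iff h).2 (Or.inr ⟨ht', htσ'⟩), hτt'⟩).trans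
        e1.symm)
  have hs'' : s ∈ cells Δ'' := by
    rcases (mem_cells_subdivision_iff h).1 hs with h' | ⟨h', hne'⟩
    · exact h'
    · exact absurd hτs (hout s h' hne')
  have hτ'' : τ ∈ Δ''.faces := Δ''.down_closed hs''.1 hτs (Δ'.nonempty_of_mem_faces hτ)
  -- So `τ` is a facet of `Δ''` lying in a facet of `σ`. That facet contains `γ`, hence is one of
  -- the two shared ones, which puts `τ` inside `t₁` or `t₂`.
  obtain ⟨v, hv, hτv⟩ := exists_facet_of_unique_cell h.finite (Δ.indep h.cell_mem.1) h.cell_mem.2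
    h.space_eq hτ'' hτc hs'' hτs fun t ht hτt =>
      huniq t ⟨(mem_cells_subdivision_iff h).2 (Or.inl ht), hτt⟩
  have hec : (σ.erase v).card = k := by rw [Finset.card_erase_of_mem hv, h.cell_mem.2]; rfl
  have hγσ : γ ⊆ σ := hγ1.trans Finset.inter_subset_left
  have hγv : γ ⊆ σ.erase v := by
    intro w hw
    have hwΔ : w ∈ Δ.vertices := mem_vertices_of_mem h.cell_mem.1 (hγσ hw)
    rcases (σ.erase v).eq_empty_or_nonempty with he | he
    · have := hτv w (hγτ hw)
      simp [he] at this
    · exact (Δ.vertex_mem_convexHull_iff hwΔ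
        (Δ.down_closed h.cell_mem.1 (Finset.erase_subset _ _) he)).1 (hτv w (hγτ hw))
  have hfin : ∀ t ∈ cells Δ, (σ ∩ t).card = k → σ.erase v ≠ σ ∩ t := by
    intro t ht hct heq
    have hf := (facet_mem_boundary h ht hct).1
    have hsub : τ ⊆ σ ∩ t := by
      intro w hw
      refine (Δ''.vertex_mem_convexHull_iff (mem_vertices_of_mem hτ'' hw) hf).1 ?_
      rw [← heq]
      exact hτv w hw
    exact hout t ht (hneσ t hct) (hsub.trans Finset.inter_subset_right)
  rcases facets_over_codim_two hγ h.cell_mem.2 hec hc1 hc2 (Finset.erase_subset _ _)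
    Finset.inter_subset_left Finset.inter_subset_left hγv hγ1 hγ2 with h' | h' | h'
  exacts [hfin t₁ h1 hc1 h', hfin t₂ h2 hc2 h', hne h']

end Subdivisions

/-! ### The extension problem around a face of codimension two. -/

section Local

open scoped Classical

variable {k r : ℕ} {Δ Δ' Δ'' : Geometry.SimplicialComplex ℝ (Fin k → ℝ)}
  {σ : Finset (Fin k → ℝ)}

/-- The jump of a spline between two cells containing `γ` lies in the ideal `J_γ`. -/
theorem sub_mem_faceIdeal {K K' : Geometry.SimplicialComplex ℝ (Fin k → ℝ)}
    (hK : K.faces ⊆ K'.faces) {f : cells K → PolyRing k} (hf : f ∈ splines r K)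
    {γ : Finset (Fin k → ℝ)} (hγ : γ.Nonempty) {s t : cells K}
    (h : Relation.ReflTransGen (AdjOver γ) s t) :
    f s - f t ∈ faceIdeal r K' γ := by
  induction h with
  | refl => simp
  | @tail q t _ hqt ih =>
    have h1 : f q - f t ∈ faceIdeal r K' γ := by
      refine Ideal.mem_of_dvd _ (facetCompatible_of_mem_splines hf q t hqt.1)
        (Ideal.subset_span ⟨q.1 ∩ t.1, hK (K.down_closed q.2.1 Finset.inter_subset_left
          (hγ.mono hqt.2)), hqt.1, hqt.2, _, form_isHomogeneous _, fun v hv => ?_, rfl⟩)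
      rw [eval_form, normal_dotProduct hqt.1 hv]
    have := add_mem ih h1
    rwa [sub_add_sub_cancel] at this

/-- The extension problem for the jump `D` across `σ` has a solution near a face of codimension two
whenever `D` is supported on a single facet `τ`. -/
theorem exists_solution_single {K : Geometry.SimplicialComplex ℝ (Fin k → ℝ)}
    (hK : IsMesh K) {γ τ : Finset (Fin k → ℝ)}
    (hconn : ∀ s t : cells K, γ ⊆ s.1 → γ ⊆ t.1 → Relation.ReflTransGen (AdjOver γ) s t)
    (hγ : γ.card + 1 = k) {σ t₁ t₂ : cells K} (h1 : AdjOver γ σ t₁) (h2 : AdjOver γ σ t₂)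
    (h12 : σ.1 ∩ t₁.1 ≠ σ.1 ∩ t₂.1) (P : Submodule ℝ (Fin (k + 1) → ℝ))
    (hP : ∀ q q' : cells K, γ ⊆ q.1 → (q.1 ∩ q'.1).card = k → normal (q.1 ∩ q'.1) ∈ P →
      γ ⊆ q.1 ∩ q'.1)
    (hτ : τ ∈ K.faces) (hτc : τ.card = k) (hγτ : γ ⊆ τ) (D : PolyRing k)
    (hD : ∀ q q' : cells K, q.1 ∩ q'.1 = τ → form (normal τ) ^ (r + 1) ∣ D) :
    ∃ g : cells K → PolyRing k,
      form (normal (σ.1 ∩ t₁.1)) ^ (r + 1) ∣ g t₁ - D ∧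
      form (normal (σ.1 ∩ t₂.1)) ^ (r + 1) ∣ g t₂ ∧
      ∀ q q' : cells K, q ≠ σ → q' ≠ σ → (q.1 ∩ q'.1).card = k → normal (q.1 ∩ q'.1) ∈ P →
        form (normal (q.1 ∩ q'.1)) ^ (r + 1) ∣ g q - g q' := by
  by_cases hτ1 : τ = σ.1 ∩ t₁.1
  · refine ⟨0, ?_, by simp, fun q q' _ _ _ _ => by simp⟩
    rw [Pi.zero_apply, zero_sub, dvd_neg, ← hτ1]
    exact hD σ t₁ hτ1.symm
  by_cases hτ2 : τ = σ.1 ∩ t₂.1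
  · refine ⟨fun _ => D, by simp, ?_, fun q q' _ _ _ _ => by simp⟩
    rw [← hτ2]
    exact hD σ t₂ hτ2.symm
  obtain ⟨c, hc, hτ'⟩ := hK.pure τ hτ
  have hnr := not_reachable_starGraph hK.finite hconn hγ h1 h2 h12 hτc hγτ (c := ⟨c, hc⟩) hτ'
    hτ1 hτ2
  have hγ1 : γ ⊆ t₁.1 := h1.2.trans Finset.inter_subset_right
  have hcross : ∀ q q' : cells K, q ≠ σ → q' ≠ σ → (q.1 ∩ q'.1).card = k →
      normal (q.1 ∩ q'.1) ∈ P → (starGraph γ σ τ).Reachable t₁ q →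
      ¬ (starGraph γ σ τ).Reachable t₁ q' → form (normal (q.1 ∩ q'.1)) ^ (r + 1) ∣ D := by
    intro q q' hq hq' hqq hn hr hr'
    have hsub := hP q q' (subset_of_reachable_starGraph hγ1 hr) hqq hn
    by_cases he : q.1 ∩ q'.1 = τ
    · rw [he]
      exact hD q q' he
    · exact absurd (hr.trans (SimpleGraph.Adj.reachable ⟨hq, hq', ⟨hqq, hsub⟩, he⟩)) hr'
  refine ⟨fun q => if (starGraph γ σ τ).Reachable t₁ q then D else 0, by simp, by simp [hnr],
    fun q q' hq hq' hqq hn => ?_⟩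
  by_cases hr : (starGraph γ σ τ).Reachable t₁ q <;>
    by_cases hr' : (starGraph γ σ τ).Reachable t₁ q' <;> simp only [hr, hr', if_true, if_false]
  · simp
  · simpa using hcross q q' hq hq' hqq hn hr hr'
  · rw [zero_sub, dvd_neg, Finset.inter_comm]
    rw [Finset.inter_comm] at hqq hn
    exact hcross q' q hq' hq hqq hn hr' hr
  · simp

/-- The extension problem can be solved at all facets whose linear forms lie in a space of
dimension two. -/
theorem exists_local_solution (hΔ : IsMesh Δ) (h : IsSplitSubdivision r Δ σ Δ'' Δ')
    [Module.Free (PolyRing k) (splines r Δ)] [Module.Free (PolyRing k) (splines r Δ'')]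
    {f : cells Δ'' → PolyRing k} (hf : f ∈ splines r Δ'') {b : cells Δ → PolyRing k}
    (hb : ∀ t : cells Δ, (σ ∩ t.1).card = k → ∃ s : cells Δ'', σ ∩ t.1 ⊆ s.1 ∧ b t = f s)
    (P : Submodule ℝ (Fin (k + 1) → ℝ)) (hP : finrank ℝ P ≤ 2) :
    ∃ g : cells Δ → PolyRing k,
      (∀ t : cells Δ, (σ ∩ t.1).card = k → normal (σ ∩ t.1) ∈ P →
        form (normal (σ ∩ t.1)) ^ (r + 1) ∣ g ⟨σ, h.cell_mem⟩ - g t - b t) ∧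
      ∀ q q' : cells Δ, q.1 ≠ σ → q'.1 ≠ σ → (q.1 ∩ q'.1).card = k →
        normal (q.1 ∩ q'.1) ∈ P → form (normal (q.1 ∩ q'.1)) ^ (r + 1) ∣ g q - g q' := by
  set σ' : cells Δ := ⟨σ, h.cell_mem⟩ with hσ'
  have hneσ : ∀ {t : cells Δ}, (σ ∩ t.1).card = k → t ≠ σ' := fun {t} ht =>
    (ne_of_inter_card (s := σ') ht).symm
  -- With at most one relevant facet of `σ`, the prescribed jump is realized by changing the value
  -- on `σ` alone.
  by_cases hA : ∀ t t' : cells Δ, (σ ∩ t.1).card = k → normal (σ ∩ t.1) ∈ P →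
      (σ ∩ t'.1).card = k → normal (σ ∩ t'.1) ∈ P → t = t'
  · by_cases hex : ∃ t : cells Δ, (σ ∩ t.1).card = k ∧ normal (σ ∩ t.1) ∈ P
    · obtain ⟨t, ht, htn⟩ := hex
      refine ⟨Pi.single σ' (b t), fun t' ht' htn' => ?_, fun q q' hq hq' _ _ => ?_⟩
      · rw [hA t' t ht' htn' ht htn, Pi.single_eq_same, Pi.single_eq_of_ne (hneσ ht)]
        simp
      · rw [Pi.single_eq_of_ne (fun h' => hq (congrArg Subtype.val h')),
          Pi.single_eq_of_ne (fun h' => hq' (congrArg Subtype.val h'))]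
        simp
    · exact ⟨0, fun t ht htn => absurd ⟨t, ht, htn⟩ hex, by simp⟩
  push Not at hA
  obtain ⟨t₁, t₂, hc1, hn1, hc2, hn2, hne⟩ := hA
  have hfac : σ ∩ t₁.1 ≠ σ ∩ t₂.1 := fun h' => hne (eq_of_inter_eq (q := σ') hc1 h')
  set γ := (σ ∩ t₁.1) ∩ (σ ∩ t₂.1) with hγdef
  have hγ1 : γ ⊆ σ ∩ t₁.1 := Finset.inter_subset_left
  have hγ2 : γ ⊆ σ ∩ t₂.1 := Finset.inter_subset_right
  obtain ⟨v, hv2, hv1⟩ : ∃ v ∈ σ ∩ t₂.1, v ∉ σ ∩ t₁.1 := by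
    by_contra hcon
    push Not at hcon
    exact hfac (Finset.eq_of_subset_of_card_le hcon (by rw [hc1, hc2])).symm
  have hins : insert v (σ ∩ t₁.1) = σ := Finset.eq_of_subset_of_card_le
    (Finset.insert_subset (Finset.mem_inter.1 hv2).1 Finset.inter_subset_left)
    (by rw [Finset.card_insert_of_notMem hv1, hc1, h.cell_mem.2])
  have hγc : γ.card + 1 = k := by
    have h1 : (σ ∩ t₁.1) ∪ (σ ∩ t₂.1) = σ := by
      refine (Finset.union_subset Finset.inter_subset_left Finset.inter_subset_left).antisymm ?_
      conv_lhs => rw [← hins]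
      exact Finset.insert_subset (Finset.mem_union_right _ hv2) Finset.subset_union_left
    have h2 := Finset.card_union_add_card_inter (σ ∩ t₁.1) (σ ∩ t₂.1)
    rw [h1, hc1, hc2, h.cell_mem.2, ← hγdef] at h2
    omega
  have hli : LinearIndependent ℝ ![normal (σ ∩ t₁.1), normal (σ ∩ t₂.1)] := by
    refine (LinearIndependent.pair_iff' (normal_ne_zero hc1)).2 fun c hc => ?_
    have h1 := normal_dotProduct_ne_zero (Δ.indep h.cell_mem.1) h.cell_mem.2
      Finset.inter_subset_left hc1 (Finset.mem_inter.1 hv2).1 hv1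
    have h2 := normal_dotProduct hc2 hv2
    rw [← hc, smul_dotProduct, smul_eq_mul] at h2
    rw [(mul_eq_zero.1 h2).resolve_right h1, zero_smul] at hc
    exact normal_ne_zero hc2 hc.symm
  -- `P` is spanned by the two normals, so all its forms vanish on `γ`. A facet with normal in `P`
  -- of a cell containing `γ` therefore contains `γ`.
  have hPeq : Submodule.span ℝ (Set.range ![normal (σ ∩ t₁.1), normal (σ ∩ t₂.1)]) = P := by
    refine Submodule.eq_of_le_of_finrank_le ?_ ?_
    · rw [Submodule.span_le]
      rintro _ ⟨i, rfl⟩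
      fin_cases i
      exacts [hn1, hn2]
    · rw [finrank_span_eq_card hli]
      simpa using hP
  have hPγ : ∀ a ∈ P, ∀ w ∈ γ, a ⬝ᵥ lift w = 0 := by
    intro a ha w hw
    rw [← hPeq] at ha
    induction ha using Submodule.span_induction with
    | mem x hx =>
      obtain ⟨i, rfl⟩ := hx
      fin_cases i
      exacts [normal_dotProduct hc1 (hγ1 hw), normal_dotProduct hc2 (hγ2 hw)]
    | zero => simp
    | add x y _ _ hx hy => rw [add_dotProduct, hx, hy, add_zero]
    | smul c x _ hx => rw [smul_dotProduct, hx, smul_zero]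
  have hsub : ∀ q q' : cells Δ, γ ⊆ q.1 → (q.1 ∩ q'.1).card = k → normal (q.1 ∩ q'.1) ∈ P →
      γ ⊆ q.1 ∩ q'.1 := by
    intro q q' hq hqq hn w hw
    by_contra hwn
    exact normal_dotProduct_ne_zero (Δ.indep q.2.1) q.2.2 Finset.inter_subset_left hqq (hq hw) hwn
      (hPγ _ hn w hw)
  have hγσ : γ ⊆ σ := hγ1.trans Finset.inter_subset_left
  have honly : ∀ t : cells Δ, (σ ∩ t.1).card = k → normal (σ ∩ t.1) ∈ P → t = t₁ ∨ t = t₂ := by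
    intro t ht htn
    rcases facets_over_codim_two hγc h.cell_mem.2 ht hc1 hc2 Finset.inter_subset_left
      Finset.inter_subset_left Finset.inter_subset_left (hsub σ' t hγσ ht htn) hγ1 hγ2
      with h' | h' | h'
    · exact Or.inl (eq_of_inter_eq (q := σ') ht h')
    · exact Or.inr (eq_of_inter_eq (q := σ') ht h')
    · exact absurd h' hfac
  have hconn : ∀ s t : cells Δ, γ ⊆ s.1 → γ ⊆ t.1 → Relation.ReflTransGen (AdjOver γ) s t :=
    fun s t => reflTransGen_adjOver_of_free r hΔ.finite
  -- Giving `σ` the value `b t₂` and the other cells `-g` removes the jump at `t₂` and leaves the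
  -- difference at `t₁`.
  suffices hsol : ∃ g : cells Δ → PolyRing k,
      form (normal (σ ∩ t₁.1)) ^ (r + 1) ∣ g t₁ - (b t₁ - b t₂) ∧
      form (normal (σ ∩ t₂.1)) ^ (r + 1) ∣ g t₂ ∧
      ∀ q q' : cells Δ, q ≠ σ' → q' ≠ σ' → (q.1 ∩ q'.1).card = k → normal (q.1 ∩ q'.1) ∈ P →
        form (normal (q.1 ∩ q'.1)) ^ (r + 1) ∣ g q - g q' by
    obtain ⟨g, hg1, hg2, hg⟩ := hsol
    have hup : ∀ q : cells Δ, q ≠ σ' → Function.update (-g) σ' (b t₂) q = - g q :=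
      fun q hq => Function.update_of_ne hq _ _
    refine ⟨Function.update (-g) σ' (b t₂), fun t ht htn => ?_, fun q q' hq hq' hqq hn => ?_⟩
    · rw [Function.update_self, hup t (hneσ ht)]
      rcases honly t ht htn with rfl | rfl
      · convert hg1 using 1; ring
      · convert hg2 using 1; ring
    · have hq1 : q ≠ σ' := fun h' => hq (congrArg Subtype.val h')
      have hq2 : q' ≠ σ' := fun h' => hq' (congrArg Subtype.val h')
      rw [hup q hq1, hup q' hq2, neg_sub_neg, ← dvd_neg, neg_sub]
      exact hg q q' hq1 hq2 hqq hn
  have hsingle := fun τ hτ hτc hγτ D hD => exists_solution_single (r := r) (τ := τ) hΔ hconn hγc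
    (σ := σ') (t₁ := t₁) (t₂ := t₂) ⟨hc1, hγ1⟩ ⟨hc2, hγ2⟩ hfac P hsub hτ hτc hγτ D hD
  by_cases hbd : ∃ τ ∈ Δ.faces, τ.card = k ∧ γ ⊆ τ ∧ ∃! s, s ∈ cells Δ ∧ τ ⊆ s
  -- No two distinct cells share a boundary facet, so the divisibility required of the difference is
  -- vacuous.
  · obtain ⟨τ, hτ, hτc, hγτ, s, -, hs⟩ := hbd
    refine hsingle τ hτ hτc hγτ _ fun q q' hqq => ?_
    refine absurd (Subtype.ext ?_) (ne_of_inter_card (hqq ▸ hτc))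
    exact (hs q.1 ⟨q.2, hqq ▸ Finset.inter_subset_left⟩).trans
      (hs q'.1 ⟨q'.2, hqq ▸ Finset.inter_subset_right⟩).symm
  · push Not at hbd
    -- An empty `γ` occurs only for `k = 1`, and then an end point of the complex is a boundary
    -- facet over it.
    have hγne : γ.Nonempty := by
      rw [Finset.nonempty_iff_ne_empty]
      intro hγ0
      have hk : k = 1 := by rw [← hγc, hγ0, Finset.card_empty]
      clear_value γ σ'
      subst hk
      obtain ⟨τ, hτ, hτc, hτu⟩ := exists_vertex_unique_cell hΔ ⟨_, h.cell_mem⟩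
      exact hbd τ hτ hτc (by rw [hγ0]; exact Finset.empty_subset _) hτu
    have hγΔ : γ ∈ Δ.faces := Δ.down_closed h.cell_mem.1 hγσ hγne
    have hγint : γ ∉ boundary Δ := by
      rintro ⟨-, τ, hτ, hτc, hγτ, hu⟩
      exact hbd τ hτ hτc hγτ hu
    have hγσ' : γ ⊂ σ := by
      refine Finset.ssubset_iff_subset_ne.2 ⟨hγσ, fun h' => ?_⟩
      have := h.cell_mem.2
      rw [← h'] at this
      omega
    have hγ'' := (h.boundary_eq γ hγΔ hγint).1 hγσ'
    have hγ' := notMem_boundary_subdivision h.toIsSimpleSubdivision hγc t₁.2 t₂.2 hc1 hc2 hγ1 hγ2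
      hfac hbd
    -- A chain of cells of `Δ''` over `γ` puts the difference in the ideal for `Δ'`; the split
    -- hypothesis moves it to the ideal for `Δ`.
    have hmem : b t₁ - b t₂ ∈ faceIdeal r Δ γ := by
      rw [← h.split γ hγ'' hγ']
      obtain ⟨s₁, hs1, e1⟩ := hb t₁ hc1
      obtain ⟨s₂, hs2, e2⟩ := hb t₂ hc2
      rw [e1, e2]
      refine sub_mem_faceIdeal ?_ hf hγne
        (reflTransGen_adjOver_of_free r h.finite (hγ1.trans hs1) (hγ2.trans hs2))
      rw [h.faces_eq]
      exact Set.subset_union_left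
    generalize b t₁ - b t₂ = D at hmem
    rw [faceIdeal] at hmem
    induction hmem using Submodule.span_induction with
    | mem p hp =>
      obtain ⟨τ, hτ, hτc, hγτ, l, hl, hlv, rfl⟩ := hp
      exact hsingle τ hτ hτc hγτ _ fun q q' _ =>
        pow_dvd_pow_of_dvd (form_normal_dvd (Δ.indep hτ) hτc hl hlv) _
    | zero => exact ⟨0, by simp, by simp, fun q q' _ _ _ _ => by simp⟩
    | add x y _ _ hx hy =>
      obtain ⟨g, hg1, hg2, hg⟩ := hx
      obtain ⟨g', hg1', hg2', hg'⟩ := hy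
      refine ⟨g + g', ?_, dvd_add hg2 hg2', fun q q' hq hq' hqq hn => ?_⟩
      · rw [Pi.add_apply, add_sub_add_comm]
        exact dvd_add hg1 hg1'
      · rw [Pi.add_apply, Pi.add_apply, add_sub_add_comm]
        exact dvd_add (hg q q' hq hq' hqq hn) (hg' q q' hq hq' hqq hn)
    | smul c x _ hx =>
      obtain ⟨g, hg1, hg2, hg⟩ := hx
      refine ⟨c • g, ?_, hg2.mul_left c, fun q q' hq hq' hqq hn => ?_⟩
      · rw [Pi.smul_apply, ← smul_sub]
        exact hg1.mul_left c
      · rw [Pi.smul_apply, Pi.smul_apply, ← smul_sub]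
        exact (hg q q' hq hq' hqq hn).mul_left c

end Local

/-! ### Global solution and extension of splines. -/

section Extension

open scoped Classical

variable {k r : ℕ} {Δ Δ' Δ'' : Geometry.SimplicialComplex ℝ (Fin k → ℝ)}
  {σ : Finset (Fin k → ℝ)}

/-- The extension problem across the facets of `σ` can be solved globally. -/
theorem exists_global_solution (hΔ : IsMesh Δ) (h : IsSplitSubdivision r Δ σ Δ'' Δ')
    [Module.Free (PolyRing k) (splines r Δ)] [Module.Free (PolyRing k) (splines r Δ'')]
    {f : cells Δ'' → PolyRing k} (hf : f ∈ splines r Δ'') {b : cells Δ → PolyRing k}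
    (hb : ∀ t : cells Δ, (σ ∩ t.1).card = k → ∃ s : cells Δ'', σ ∩ t.1 ⊆ s.1 ∧ b t = f s) :
    ∃ w : cells Δ → PolyRing k,
      (∀ t : cells Δ, (σ ∩ t.1).card = k →
        form (normal (σ ∩ t.1)) ^ (r + 1) ∣ w ⟨σ, h.cell_mem⟩ - w t - b t) ∧
      ∀ q q' : cells Δ, q.1 ≠ σ → q'.1 ≠ σ → (q.1 ∩ q'.1).card = k →
        form (normal (q.1 ∩ q'.1)) ^ (r + 1) ∣ w q - w q' := by
  have hfin : Finite (cells Δ) := (hΔ.finite.subset fun s hs => hs.1).to_subtype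
  set σ' : cells Δ := ⟨σ, h.cell_mem⟩ with hσ'
  let Pairs := {p : cells Δ × cells Δ // (p.1.1 ∩ p.2.1).card = k}
  have : Fintype Pairs := Fintype.ofFinite _
  let n : Pairs → Fin (k + 1) → ℝ := fun p => normal (p.1.1.1 ∩ p.1.2.1)
  let I : Pairs → Ideal (PolyRing k) := fun p => Ideal.span {form (n p) ^ (r + 1)}
  let φ : (cells Δ → PolyRing k) →ₗ[PolyRing k] ∀ p, PolyRing k ⧸ I p := LinearMap.pi fun p =>
    (I p).mkQ ∘ₗ ((LinearMap.proj p.1.1 : (cells Δ → PolyRing k) →ₗ[PolyRing k] PolyRing k) -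
      LinearMap.proj p.1.2)
  have hφ : ∀ g p, φ g p = Ideal.Quotient.mk (I p) (g p.1.1 - g p.1.2) := fun _ _ => rfl
  have hmk : ∀ p x y, Ideal.Quotient.mk (I p) x = Ideal.Quotient.mk (I p) y ↔
      form (n p) ^ (r + 1) ∣ x - y := fun p x y => by
    rw [Ideal.Quotient.eq, Ideal.mem_span_singleton]
  have hker : LinearMap.ker φ = splines r Δ := by
    ext g
    rw [LinearMap.mem_ker]
    constructor
    · intro hg
      refine mem_splines_of_facetCompatible hΔ.finite fun s t hst => ?_
      have := congrFun hg ⟨(s, t), hst⟩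
      rw [hφ, Pi.zero_apply, ← map_zero (Ideal.Quotient.mk _), hmk, sub_zero] at this
      exact this
    · intro hg
      funext p
      rw [hφ, Pi.zero_apply, ← map_zero (Ideal.Quotient.mk _), hmk, sub_zero]
      exact facetCompatible_of_mem_splines hg _ _ p.2
  have hfree : Module.Free (PolyRing k) (LinearMap.ker φ) := by rw [hker]; infer_instance
  -- Pairs are ordered, hence the sign when `σ` comes second.
  let j : cells Δ → cells Δ → PolyRing k := fun q q' =>
    if q = σ' then b q' else if q' = σ' then - b q else 0
  let u : ∀ p, PolyRing k ⧸ I p := fun p => Ideal.Quotient.mk (I p) (j p.1.1 p.1.2)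
  have hu : u ∈ LinearMap.range φ := by
    refine mem_range_of_prod_smul_mem φ n r u ?_ ?_
    · intro a c hac m ha hc
      funext p
      obtain ⟨x, hx⟩ := Ideal.Quotient.mk_surjective (m p)
      have hp : Prime (form (n p)) := prime_form (normal_ne_zero p.2)
      -- A form not divisible by the facet form acts injectively on the quotient, and of two
      -- independent forms at most one is divisible.
      have key : ∀ d : Fin (k + 1) → ℝ, form d • m = 0 → ¬ form (n p) ∣ form d → m p = 0 := by
        intro d hd hnd
        have h1 := congrFun hd p
        rw [Pi.smul_apply, ← hx, Pi.zero_apply] at h1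
        have h2 : Ideal.Quotient.mk (I p) (form d * x) = Ideal.Quotient.mk (I p) 0 := by
          rw [map_zero]; exact h1
        rw [hmk, sub_zero] at h2
        rw [← hx, ← map_zero (Ideal.Quotient.mk _), hmk, sub_zero]
        exact hp.pow_dvd_of_dvd_mul_left _ hnd h2
      by_cases hda : form (n p) ∣ form a
      · refine key c hc fun hdc => ?_
        rw [form_dvd_form_iff (normal_ne_zero p.2), Submodule.mem_span_singleton] at hda hdc
        obtain ⟨x, hx⟩ := hda
        obtain ⟨y, hy⟩ := hdc
        have ha0 : a ≠ 0 := hac.ne_zero 0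
        have hx0 : x ≠ 0 := by
          rintro rfl
          exact ha0 (by rw [← hx, zero_smul])
        refine (LinearIndependent.pair_iff' ha0).1 hac (y * x⁻¹) ?_
        rw [← hx, ← hy, smul_smul, inv_mul_cancel_right₀ hx0]
      · exact key a ha hda
    · intro e he
      obtain ⟨g, hg1, hg2⟩ := exists_local_solution hΔ h hf hb _ he
      refine ⟨(∏ p, form (n p) ^ e p) • g, ?_⟩
      funext p
      have h1 : ((∏ p, form (n p) ^ e p) • u) p
          = Ideal.Quotient.mk (I p) ((∏ p, form (n p) ^ e p) * j p.1.1 p.1.2) := rfl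
      rw [hφ, h1, hmk, Pi.smul_apply, Pi.smul_apply, smul_eq_mul, smul_eq_mul, ← mul_sub,
        ← mul_sub]
      -- Exponents below `r + 1` are handled by the local solution for the span of their normals.
      -- For the others the product is already zero in the quotient.
      by_cases hp : e p < r + 1
      · refine Dvd.dvd.mul_left ?_ _
        have hmem : n p ∈ Submodule.span ℝ (n '' {p | e p < r + 1}) :=
          Submodule.subset_span ⟨p, hp, rfl⟩
        obtain ⟨⟨q, q'⟩, hqq⟩ := p
        have hqq : (q.1 ∩ q'.1).card = k := hqq
        simp only [n] at hmem ⊢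
        simp only [j]
        split_ifs with hq hq'
        · subst hq
          exact hg1 q' hqq hmem
        · subst hq'
          rw [Finset.inter_comm] at hqq hmem ⊢
          rw [← dvd_neg]
          convert hg1 q hqq hmem using 1
          ring
        · rw [sub_zero]
          exact hg2 q q' (fun h' => hq (Subtype.ext h')) (fun h' => hq' (Subtype.ext h')) hqq hmem
      · refine Dvd.dvd.mul_right ?_ _
        exact (pow_dvd_pow _ (not_lt.1 hp)).trans
          (Finset.dvd_prod_of_mem (fun p => form (n p) ^ e p) (Finset.mem_univ p))
  obtain ⟨w, hw⟩ := hu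
  have key : ∀ p : Pairs, form (n p) ^ (r + 1) ∣ w p.1.1 - w p.1.2 - j p.1.1 p.1.2 := fun p =>
    (hmk p _ _).1 (congrFun hw p)
  refine ⟨w, fun t ht => ?_, fun q q' hq hq' hqq => ?_⟩
  · have := key ⟨(σ', t), ht⟩
    simpa only [j, if_true] using this
  · have := key ⟨(q, q'), hqq⟩
    have h1 : q ≠ σ' := fun h' => hq (congrArg Subtype.val h')
    have h2 : q' ≠ σ' := fun h' => hq' (congrArg Subtype.val h')
    simpa only [j, if_neg h1, if_neg h2, sub_zero] using this

/-- Every spline on the subdivision of `σ` extends to a spline on the subdivision of the mesh. -/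
theorem exists_extension (hΔ : IsMesh Δ) (h : IsSplitSubdivision r Δ σ Δ'' Δ')
    [Module.Free (PolyRing k) (splines r Δ)] [Module.Free (PolyRing k) (splines r Δ'')]
    {f : cells Δ'' → PolyRing k} (hf : f ∈ splines r Δ'') :
    ∃ g ∈ splines r Δ', ∀ (s : cells Δ'') (hs : s.1 ∈ cells Δ'), g ⟨s.1, hs⟩ = f s := by
  have hS := h.toIsSimpleSubdivision
  set σ' : cells Δ := ⟨σ, h.cell_mem⟩ with hσ'
  let b : cells Δ → PolyRing k := fun t =>
    if ht : ∃ s : cells Δ'', σ ∩ t.1 ⊆ s.1 then f ht.choose else 0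
  have hb : ∀ t : cells Δ, (σ ∩ t.1).card = k → ∃ s : cells Δ'', σ ∩ t.1 ⊆ s.1 ∧ b t = f s := by
    intro t ht
    obtain ⟨s, hs, hsub⟩ := exists_cell_over_facet hS t.2 ht
    have hex : ∃ s : cells Δ'', σ ∩ t.1 ⊆ s.1 := ⟨⟨s, hs⟩, hsub⟩
    exact ⟨hex.choose, hex.choose_spec, dif_pos hex⟩
  obtain ⟨w, hw1, hw2⟩ := exists_global_solution hΔ h hf hb
  -- Subtracting from the value on `σ` turns prescribed jumps into prescribed values on the
  -- neighbours of `σ`.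
  let G : cells Δ → PolyRing k := fun t => w σ' - w t
  have hG1 : ∀ t : cells Δ, (σ ∩ t.1).card = k →
      ∃ s : cells Δ'', σ ∩ t.1 ⊆ s.1 ∧ form (normal (σ ∩ t.1)) ^ (r + 1) ∣ G t - f s := by
    intro t ht
    obtain ⟨s, hs, e⟩ := hb t ht
    exact ⟨s, hs, e ▸ hw1 t ht⟩
  have hG2 : ∀ q q' : cells Δ, q.1 ≠ σ → q'.1 ≠ σ → (q.1 ∩ q'.1).card = k →
        form (normal (q.1 ∩ q'.1)) ^ (r + 1) ∣ G q - G q' := by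
    intro q q' hq hq' hqq
    simp only [G, sub_sub_sub_cancel_left]
    rw [← dvd_neg, neg_sub]
    exact hw2 q q' hq hq' hqq
  -- Jets at a point over `γ` are compared along a chain of cells of `Δ`. When the chain meets `σ`,
  -- any piece of `f` over `γ` may stand in for it, since `f` is a spline.
  have chain : ∀ {γ : Finset (Fin k → ℝ)} {x : Fin (k + 1) → ℝ}, x ∈ coneCell γ →
      ∀ t₀ q : cells Δ, t₀.1 ≠ σ → γ ⊆ t₀.1 → γ ⊆ q.1 →
      (q.1 ≠ σ → VanishesAt r (G t₀ - G q) x) ∧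
      (q.1 = σ → ∀ s : cells Δ'', γ ⊆ s.1 → VanishesAt r (G t₀ - f s) x) := by
    intro γ x hx t₀ q ht₀ hγ0 hγq
    have hch := reflTransGen_adjOver_of_free r hΔ.finite hγ0 hγq
    clear hγq
    induction hch with
    | refl =>
      refine ⟨fun _ => ?_, fun h' => absurd h' ht₀⟩
      rw [sub_self]
      exact vanishesAt_zero r x
    | @tail q q' _ hqq ih =>
      have hface : ∀ {p : PolyRing k}, form (normal (q.1 ∩ q'.1)) ^ (r + 1) ∣ p →
          VanishesAt r p x := fun hp =>
        vanishesAt_of_normal_pow_dvd hqq.1 hp (coneCell_mono hqq.2 hx)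
      by_cases hq : q.1 = σ
      · have hq' : q'.1 ≠ σ := fun h' => ne_of_inter_card hqq.1 (Subtype.ext (hq.trans h'.symm))
        refine ⟨fun _ => ?_, fun h' => absurd h' hq'⟩
        rw [AdjOver, hq] at hqq
        rw [hq] at hface
        obtain ⟨s, hs, hd⟩ := hG1 q' hqq.1
        have := (ih.2 hq s (hqq.2.trans hs)).sub (hface hd)
        rwa [sub_sub_sub_cancel_right] at this
      · refine ⟨fun hq' => ?_, fun hq' s hs => ?_⟩
        · have := (ih.1 hq).add (hface (hG2 q q' hq hq' hqq.1))
          rwa [sub_add_sub_cancel] at this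
        · rw [AdjOver, hq', Finset.inter_comm] at hqq
          rw [hq', Finset.inter_comm] at hface
          obtain ⟨s', hs', hd⟩ := hG1 q hqq.1
          have h1 := (ih.1 hq).add (hface hd)
          have h2 := h1.add (vanishesAt_of_mem_splines hf s' s
            (coneCell_mono (hqq.2.trans hs') hx) (coneCell_mono hs hx))
          rwa [sub_add_sub_cancel, sub_add_sub_cancel] at h2
  let g : cells Δ' → PolyRing k := fun s =>
    if h1 : s.1 ∈ cells Δ'' then f ⟨s.1, h1⟩ else
      if h2 : s.1 ∈ cells Δ then G ⟨s.1, h2⟩ else 0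
  have hg1 : ∀ (s : cells Δ'') (hs : s.1 ∈ cells Δ'), g ⟨s.1, hs⟩ = f s := fun s hs => dif_pos s.2
  have hg2 : ∀ (t : cells Δ), t.1 ≠ σ → ∀ ht : t.1 ∈ cells Δ', g ⟨t.1, ht⟩ = G t :=
    fun t ht _ => by
      simp only [g, dif_neg (notMem_cells_of_subdivision hS t.2 ht), dif_pos t.2]
  have hmixed : ∀ (s : cells Δ'') (t : cells Δ) (hs : s.1 ∈ cells Δ') (ht : t.1 ∈ cells Δ'),
      t.1 ≠ σ → ∀ x ∈ coneCell s.1, x ∈ coneCell t.1 → VanishesAt r (G t - f s) x := by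
    intro s t hs ht htσ x hxs hxt
    have hx := coneCell_inter_subset hs.1 ht.1 ⟨hxs, hxt⟩
    exact (chain hx t σ' htσ Finset.inter_subset_right
      (inter_subset_of_subdivision hS s.2.1 t.2.1)).2 rfl s Finset.inter_subset_left
  refine ⟨g, (mem_splines_iff (finite_faces_subdivision hS hΔ.finite)).2 ?_, hg1⟩
  rintro ⟨s, hs⟩ ⟨t, ht⟩ x hxs hxt
  rcases (mem_cells_subdivision_iff hS).1 hs with hs' | ⟨hs', hsσ⟩ <;>
    rcases (mem_cells_subdivision_iff hS).1 ht with ht' | ⟨ht', htσ⟩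
  · rw [hg1 ⟨s, hs'⟩, hg1 ⟨t, ht'⟩]
    exact vanishesAt_of_mem_splines hf _ _ hxs hxt
  · rw [hg1 ⟨s, hs'⟩, hg2 ⟨t, ht'⟩ htσ, ← neg_sub]
    exact (hmixed ⟨s, hs'⟩ ⟨t, ht'⟩ hs ht htσ x hxs hxt).neg
  · rw [hg1 ⟨t, ht'⟩, hg2 ⟨s, hs'⟩ hsσ]
    exact hmixed ⟨t, ht'⟩ ⟨s, hs'⟩ ht hs hsσ x hxt hxs
  · rw [hg2 ⟨s, hs'⟩ hsσ, hg2 ⟨t, ht'⟩ htσ]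
    exact (chain (coneCell_inter_subset hs.1 ht.1 ⟨hxs, hxt⟩) ⟨s, hs'⟩ ⟨t, ht'⟩ hsσ
      Finset.inter_subset_left Finset.inter_subset_right).1 htσ

end Extension

/-! ### Splitting of surjections onto free modules. -/

section Splitting

variable {R : Type*} [CommRing R]

/-- A surjection onto a projective module splits. -/
theorem nonempty_prod_equiv {M Q : Type*} [AddCommGroup M] [Module R M] [AddCommGroup Q]
    [Module R Q] [Module.Projective R Q] (ρ : M →ₗ[R] Q) (hρ : Function.Surjective ρ) :
    Nonempty ((LinearMap.ker ρ × Q) ≃ₗ[R] M) := by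
  obtain ⟨s, hs⟩ := Module.projective_lifting_property ρ LinearMap.id hρ
  have hs' : ∀ q, ρ (s q) = q := fun q => LinearMap.congr_fun hs q
  refine ⟨LinearEquiv.ofBijective ((LinearMap.ker ρ).subtype.coprod s) ⟨?_, fun m => ?_⟩⟩
  · rw [← LinearMap.ker_eq_bot, LinearMap.ker_eq_bot']
    rintro ⟨⟨x, hx⟩, q⟩ hxq
    rw [LinearMap.coprod_apply, Submodule.subtype_apply] at hxq
    have h1 := congrArg ρ hxq
    rw [map_add, LinearMap.mem_ker.1 hx, hs', zero_add, map_zero] at h1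
    subst h1
    rw [map_zero, add_zero] at hxq
    have hx0 : x = 0 := hxq
    subst hx0
    rfl
  · refine ⟨(⟨m - s (ρ m), by rw [LinearMap.mem_ker, map_sub, hs', sub_self]⟩, ρ m), ?_⟩
    simp

/-- If `M` is an extension of a nontrivial free module by a module which becomes free after adding
a free summand of rank one, then `M` is free. -/
theorem free_of_surjective {M Q S : Type*} [AddCommGroup M] [Module R M] [AddCommGroup Q]
    [Module R Q] [AddCommGroup S] [Module R S] [Module.Free R Q] [Nontrivial Q] [Module.Free R S]
    (ρ : M →ₗ[R] Q) (hρ : Function.Surjective ρ) (ε : S →ₗ[R] R) (hε : Function.Surjective ε)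
    (e : LinearMap.ker ε ≃ₗ[R] LinearMap.ker ρ) : Module.Free R M := by
  obtain ⟨e1⟩ := nonempty_prod_equiv ρ hρ
  obtain ⟨e2⟩ := nonempty_prod_equiv ε hε
  let B := Module.Free.chooseBasis R Q
  obtain ⟨i⟩ : Nonempty (Module.Free.ChooseBasisIndex R Q) := B.index_nonempty
  classical
  let I := {x // x ≠ i}
  -- One basis coordinate of `Q` is split off; this copy of `R` completes `ker ε` to `S`.
  let e3 : Q ≃ₗ[R] R × (I →₀ R) := B.repr.trans
    ((Finsupp.domLCongr ((Equiv.optionSubtypeNe i).symm.trans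
    ((Equiv.optionEquivSumPUnit I).trans (Equiv.sumComm _ _)))).trans
    ((Finsupp.sumFinsuppLEquivProdFinsupp R).trans
      ((Finsupp.uniqueLinearEquiv R R PUnit.unit.{1}).prodCongr (LinearEquiv.refl R _))))
  let e4 : M ≃ₗ[R] S × (I →₀ R) := e1.symm.trans ((e.symm.prodCongr e3).trans
    ((LinearEquiv.prodAssoc R _ _ _).symm.trans (e2.prodCongr (LinearEquiv.refl R _))))
  exact Module.Free.of_equiv e4.symm

end Splitting

/-! ### The exact sequence of spline modules and the conclusion. -/

section Main

open scoped Classical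

variable {k r : ℕ} {Δ Δ' Δ'' : Geometry.SimplicialComplex ℝ (Fin k → ℝ)}
  {σ : Finset (Fin k → ℝ)}

/-- Restriction of splines on the subdivided mesh to the subdivision of `σ`. -/
def restrictSplines (r : ℕ) (h : IsSimpleSubdivision Δ σ Δ'' Δ') :
    splines r Δ' →ₗ[PolyRing k] splines r Δ'' where
  toFun g := ⟨fun s => g.1 ⟨s.1, (mem_cells_subdivision_iff h).2 (Or.inl s.2)⟩,
    (mem_splines_iff h.finite).2 fun _ _ _ hs ht => vanishesAt_of_mem_splines g.2 _ _ hs ht⟩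
  map_add' _ _ := rfl
  map_smul' _ _ := rfl

/-- Evaluation of splines at a cell. -/
def evalCell (r : ℕ) {K : Geometry.SimplicialComplex ℝ (Fin k → ℝ)} (s : cells K) :
    splines r K →ₗ[PolyRing k] PolyRing k := LinearMap.proj s ∘ₗ (splines r K).subtype

theorem const_mem_splines (K : Geometry.SimplicialComplex ℝ (Fin k → ℝ)) (p : PolyRing k) :
    (fun _ => p) ∈ splines r K :=
  ⟨fun x => eval x p, (contDiff_eval p).contDiffOn, fun _ _ _ => rfl⟩

/-- Extension by zero of piecewise polynomials on the cells other than `σ` to the subdivision. -/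
def extendByZero (Δ' : Geometry.SimplicialComplex ℝ (Fin k → ℝ)) (f : cells Δ → PolyRing k) :
    cells Δ' → PolyRing k := fun s => if hs : s.1 ∈ cells Δ then f ⟨s.1, hs⟩ else 0

/-- Replacement of the subdivided cell by a cell with the zero polynomial. -/
def contractByZero (h : IsSimpleSubdivision Δ σ Δ'' Δ') (g : cells Δ' → PolyRing k) :
    cells Δ → PolyRing k := fun t =>
  if ht : t.1 ≠ σ then g ⟨t.1, (mem_cells_subdivision_iff h).2 (Or.inr ⟨t.2, ht⟩)⟩ else 0

theorem extendByZero_apply {f : cells Δ → PolyRing k} (t : cells Δ) (ht : t.1 ∈ cells Δ') :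
    extendByZero Δ' f ⟨t.1, ht⟩ = f t := dif_pos t.2

theorem extendByZero_of_mem (h : IsSimpleSubdivision Δ σ Δ'' Δ') {f : cells Δ → PolyRing k}
    (hf : f ⟨σ, h.cell_mem⟩ = 0) {s : cells Δ'} (hs : s.1 ∈ cells Δ'') :
    extendByZero Δ' f s = 0 := by
  unfold extendByZero
  split_ifs with h1
  · have hsσ : s.1 = σ := by
      by_contra hne
      exact notMem_cells_of_subdivision h h1 hne hs
    rw [← hf]
    congr 1
    exact Subtype.ext hsσ
  · rfl

theorem contractByZero_self (h : IsSimpleSubdivision Δ σ Δ'' Δ') (g : cells Δ' → PolyRing k)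
    {t : cells Δ} (ht : t.1 = σ) : contractByZero h g t = 0 := dif_neg (not_not.2 ht)

theorem contractByZero_of_ne (h : IsSimpleSubdivision Δ σ Δ'' Δ') (g : cells Δ' → PolyRing k)
    {t : cells Δ} (ht : t.1 ≠ σ) : contractByZero h g t =
      g ⟨t.1, (mem_cells_subdivision_iff h).2 (Or.inr ⟨t.2, ht⟩)⟩ := dif_pos ht

/-- A cell of `Δ''` meets another cell `t` inside `σ`, where the piece on `t` agrees to order `r`
with the zero piece on `σ`. -/
theorem extendByZero_mem_splines (hΔ : Δ.faces.Finite) (h : IsSimpleSubdivision Δ σ Δ'' Δ')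
    {f : cells Δ → PolyRing k} (hf : f ∈ splines r Δ) (hf0 : f ⟨σ, h.cell_mem⟩ = 0) :
    extendByZero Δ' f ∈ splines r Δ' := by
  have hmixed : ∀ s ∈ cells Δ'', ∀ t : cells Δ, ∀ x ∈ coneCell s, x ∈ coneCell t.1 →
      s ∈ cells Δ' → t.1 ∈ cells Δ' → VanishesAt r (f t) x := by
    intro s hs t x hxs hxt hs' ht'
    have hx := coneCell_inter_subset hs'.1 ht'.1 ⟨hxs, hxt⟩
    have := vanishesAt_of_mem_splines hf t ⟨σ, h.cell_mem⟩ hxt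
      (coneCell_mono (inter_subset_of_subdivision h hs.1 t.2.1) hx)
    rwa [hf0, sub_zero] at this
  refine (mem_splines_iff (finite_faces_subdivision h hΔ)).2 ?_
  rintro ⟨s, hs⟩ ⟨t, ht⟩ x hxs hxt
  rcases (mem_cells_subdivision_iff h).1 hs with hs1 | ⟨hs1, -⟩ <;>
    rcases (mem_cells_subdivision_iff h).1 ht with ht1 | ⟨ht1, -⟩
  · rw [extendByZero_of_mem h hf0 (s := ⟨s, hs⟩) hs1, extendByZero_of_mem h hf0 (s := ⟨t, ht⟩) ht1, sub_zero]
    exact vanishesAt_zero r x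
  · rw [extendByZero_of_mem h hf0 (s := ⟨s, hs⟩) hs1, extendByZero_apply ⟨t, ht1⟩, zero_sub]
    exact (hmixed s hs1 ⟨t, ht1⟩ x hxs hxt hs ht).neg
  · rw [extendByZero_of_mem h hf0 (s := ⟨t, ht⟩) ht1, extendByZero_apply ⟨s, hs1⟩, sub_zero]
    exact hmixed t ht1 ⟨s, hs1⟩ x hxt hxs ht hs
  · rw [extendByZero_apply ⟨s, hs1⟩, extendByZero_apply ⟨t, ht1⟩]
    exact vanishesAt_of_mem_splines hf _ _ hxs hxt

/-- Freeness leaves only the facets to check, and each shared facet of `σ` lies in a cell of `Δ''`,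
where `g` is zero. -/
theorem contractByZero_mem_splines (hΔ : Δ.faces.Finite) (h : IsSimpleSubdivision Δ σ Δ'' Δ')
    [Module.Free (PolyRing k) (splines r Δ)] {g : cells Δ' → PolyRing k} (hg : g ∈ splines r Δ')
    (hg0 : ∀ s : cells Δ', s.1 ∈ cells Δ'' → g s = 0) :
    contractByZero h g ∈ splines r Δ := by
  have hmixed : ∀ t : cells Δ, (σ ∩ t.1).card = k → t.1 ≠ σ →
      form (normal (σ ∩ t.1)) ^ (r + 1) ∣ contractByZero h g t := by
    intro t ht htσ
    rw [contractByZero_of_ne h g htσ]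
    obtain ⟨s, hs, hsub⟩ := exists_cell_over_facet h t.2 ht
    refine form_normal_pow_dvd (affineIndependent_of_subset t.2.1 Finset.inter_subset_right) ht
      fun x hx => ?_
    have := vanishesAt_of_mem_splines hg
      ⟨t.1, (mem_cells_subdivision_iff h).2 (Or.inr ⟨t.2, htσ⟩)⟩
      ⟨s, (mem_cells_subdivision_iff h).2 (Or.inl hs)⟩
      (coneCell_mono Finset.inter_subset_right hx) (coneCell_mono hsub hx)
    rwa [hg0 ⟨s, _⟩ hs, sub_zero] at this
  refine mem_splines_of_facetCompatible hΔ fun s t hst => ?_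
  by_cases hs1 : s.1 = σ <;> by_cases ht1 : t.1 = σ
  · rw [contractByZero_self h g hs1, contractByZero_self h g ht1, sub_zero]
    exact dvd_zero _
  · rw [contractByZero_self h g hs1, zero_sub, dvd_neg, hs1]
    exact hmixed t (hs1 ▸ hst) ht1
  · rw [contractByZero_self h g ht1, sub_zero, ht1, Finset.inter_comm]
    exact hmixed s (by rwa [Finset.inter_comm, ← ht1]) hs1
  · rw [contractByZero_of_ne h g hs1, contractByZero_of_ne h g ht1]
    exact facetCompatible_of_mem_splines hg
      ⟨s.1, (mem_cells_subdivision_iff h).2 (Or.inr ⟨s.2, hs1⟩)⟩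
      ⟨t.1, (mem_cells_subdivision_iff h).2 (Or.inr ⟨t.2, ht1⟩)⟩ hst

/-- The splines vanishing on `σ` correspond to the splines vanishing on its subdivision. -/
def kerEquiv (hΔ : Δ.faces.Finite) (h : IsSimpleSubdivision Δ σ Δ'' Δ')
    [Module.Free (PolyRing k) (splines r Δ)] :
    LinearMap.ker (evalCell r (⟨σ, h.cell_mem⟩ : cells Δ)) ≃ₗ[PolyRing k]
      LinearMap.ker (restrictSplines r h) where
  toFun f := ⟨⟨extendByZero Δ' f.1.1, extendByZero_mem_splines hΔ h f.1.2 f.2⟩,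
    Subtype.ext (funext fun s => extendByZero_of_mem h f.2 s.2)⟩
  invFun g := ⟨⟨contractByZero h g.1.1, contractByZero_mem_splines hΔ h g.1.2 fun s hs =>
    congrFun (congrArg Subtype.val (LinearMap.mem_ker.1 g.2)) ⟨s.1, hs⟩⟩,
    contractByZero_self h g.1.1 rfl⟩
  map_add' f g := by
    refine Subtype.ext (Subtype.ext (funext fun s => ?_))
    change extendByZero Δ' (f.1.1 + g.1.1) s = extendByZero Δ' f.1.1 s + extendByZero Δ' g.1.1 s
    unfold extendByZero
    split_ifs <;> simp
  map_smul' c f := by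
    refine Subtype.ext (Subtype.ext (funext fun s => ?_))
    change extendByZero Δ' (c • f.1.1) s = c • extendByZero Δ' f.1.1 s
    unfold extendByZero
    split_ifs <;> simp
  left_inv f := by
    refine Subtype.ext (Subtype.ext (funext fun t => ?_))
    change contractByZero h (extendByZero Δ' f.1.1) t = f.1.1 t
    by_cases h1 : t.1 = σ
    · rw [contractByZero_self h _ h1]
      have hf0 : f.1.1 ⟨σ, h.cell_mem⟩ = 0 := f.2
      rw [← hf0]
      exact congrArg f.1.1 (Subtype.ext h1.symm)
    · rw [contractByZero_of_ne h _ h1, extendByZero_apply]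
  right_inv g := by
    refine Subtype.ext (Subtype.ext (funext fun s => ?_))
    change extendByZero Δ' (contractByZero h g.1.1) s = g.1.1 s
    rcases (mem_cells_subdivision_iff h).1 s.2 with h1 | ⟨h1, h2⟩
    · rw [extendByZero_of_mem h (contractByZero_self h _ rfl) h1]
      exact (congrFun (congrArg Subtype.val (LinearMap.mem_ker.1 g.2)) ⟨s.1, h1⟩).symm
    · rw [extendByZero_apply ⟨s.1, h1⟩ s.2, contractByZero_of_ne h g.1.1 (t := ⟨s.1, h1⟩) h2]

theorem eq_subdivision_of_cells_eq (h : IsSimpleSubdivision Δ σ Δ'' Δ')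
    (hcells : ∀ t ∈ cells Δ, t = σ) : Δ' = Δ'' := by
  have : Δ'.faces = Δ''.faces := by
    rw [h.faces_eq, Set.union_eq_left]
    rintro γ ⟨-, t, ht, hne, -⟩
    exact absurd (hcells t ht) hne
  exact Geometry.SimplicialComplex.ext this

theorem free_splines_of_isSplitSubdivision (hΔ : IsMesh Δ) (h : IsSplitSubdivision r Δ σ Δ'' Δ')
    [Module.Free (PolyRing k) (splines r Δ)] [Module.Free (PolyRing k) (splines r Δ'')] :
    Module.Free (PolyRing k) (splines r Δ') := by
  have hS := h.toIsSimpleSubdivision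
  by_cases hcells : ∀ t ∈ cells Δ, t = σ
  · rw [eq_subdivision_of_cells_eq hS hcells]
    infer_instance
  push Not at hcells
  obtain ⟨t, ht, htσ⟩ := hcells
  -- A chain over the empty set leaves `σ` through a shared facet, over which `Δ''` has a cell. This
  -- makes the splines on `Δ''` a nontrivial module, so that a rank-one summand can be split off.
  obtain ⟨s, hs⟩ : (cells Δ'').Nonempty := by
    have hch := reflTransGen_adjOver_of_free r hΔ.finite (K := Δ) (s := ⟨σ, h.cell_mem⟩)
      (t := ⟨t, ht⟩) (Finset.empty_subset _) (Finset.empty_subset _)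
    rcases Relation.ReflTransGen.cases_head hch with h' | ⟨q, hq, -⟩
    · exact absurd (congrArg Subtype.val h').symm htσ
    · obtain ⟨s, hs, -⟩ := exists_cell_over_facet hS q.2 hq.1
      exact ⟨s, hs⟩
  have : Nontrivial (splines r Δ'') := by
    refine ⟨⟨⟨_, const_mem_splines Δ'' 1⟩, 0, fun h' => ?_⟩⟩
    exact one_ne_zero (congrFun (congrArg Subtype.val h') ⟨s, hs⟩)
  refine free_of_surjective (restrictSplines r hS) (fun f => ?_)
    (evalCell r (⟨σ, h.cell_mem⟩ : cells Δ)) (fun p => ⟨⟨_, const_mem_splines Δ p⟩, rfl⟩)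
    (kerEquiv hΔ.finite hS)
  obtain ⟨g, hg, hgf⟩ := exists_extension hΔ h f.2
  exact ⟨⟨g, hg⟩, Subtype.ext (funext fun s => hgf s _)⟩

end Main

end SplitSpline

end

theorem theorem2p9 (k r : ℕ) (Δ Δ' Δ'' : Geometry.SimplicialComplex ℝ (Fin k → ℝ))
    (σ : Finset (Fin k → ℝ)) (hΔ : SplitSpline.IsMesh Δ)
    (hsplit : SplitSpline.IsSplitSubdivision r Δ σ Δ'' Δ')
    (hfree : Module.Free (SplitSpline.PolyRing k) (SplitSpline.splines r Δ))
    (hfree'' : Module.Free (SplitSpline.PolyRing k) (SplitSpline.splines r Δ'')) :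
    Module.Free (SplitSpline.PolyRing k) (SplitSpline.splines r Δ') := by
  exact SplitSpline.free_splines_of_isSplitSubdivision hΔ hsplit
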